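/- \textbf{Model.} A dynamic graph $\mathcal G$ consists of a finite simple underlying graph $G=(V,E)$ with $n=|V|$ nodes and $m=|E|$ edges, and, for every time $t\in\mathbb N=\{0,1,\dots\}$, a set $\mathcal E(t)\subseteq E$ of edges present at time $t$. Nodes have distinct labels in $\mathbb N$, and the neighbours in $G$ of each node $v$ are numbered bijectively by the ports $1,\dots,\delta(v)$, where $\delta(v)$ is the degree of $v$ in $G$. For an integer $T\ge 1$, $\mathcal G$ is $T$-interval-connected if for all $t$ the graph $\bigl(V,\bigcap_{i=t}^{t+T-1}\mathcal E(i)\bigr)$ is connected. In the $KT_0$ model, a single agent starts at an arbitrary node at time $0$; at each time $t$ it receives the label and the degree in $G$ of its current node, the set of ports of this node whose edges are present at time $t$, and the port through which it has just arrived (nothing at time $0$), and then either moves along an edge present at time $t$ by selecting the port of that edge, arriving at time $t+1$, or terminates. A deterministic algorithm is a function that maps the sequence of all observations made so far to the next action; it knows none of $n$, $m$, $T$ in advance. It explores $\mathcal G$ in time $s$ if, from every starting node, the agent terminates at some time at most $s$, and has visited all nodes by then. Put $\epsilon(n,m)=\dfrac{\ln n}{1+\ln m-\ln n}$, and let $\log$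 be the logarithm to base $2$. \textbf{Theorem.} In the $KT_0$ model there exist a function $\tau$ with positive integer values such that $\tau(n,m)=O(\epsilon(n,m)\cdot m+n\log^2 n)$ and a deterministic algorithm $\mathcal A$ such that, for all integers $n\ge 3$ and $n\le m\le\binom n2$, a single agent running $\mathcal A$ explores every $\tau(n,m)$-interval-connected dynamic graph with $n$ nodes and $m$ edges in $O((m-n+1)n+n\log^2 n)$ time. The constants hidden in both $O(\cdot)$ are absolute and the bounds hold for all such $n$ and $m$. -/

import Mathlib

/-- `ε(n,m) = ln n / (1 + ln m - ln n)`. -/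
noncomputable def explEps (n m : ℕ) : ℝ :=
  Real.log n / (1 + Real.log m - Real.log n)

/-- A dynamic graph on the node set `V`: an underlying graph, and for every time `t` a snapshot
whose edges are edges of the underlying graph, together with unique node labels and a local
port numbering: at each node `v`, the map `port v` is a bijection from the neighbours of `v` in the
underlying graph onto `{1, …, δ(v)}` (its values elsewhere are irrelevant). -/
structure DynGraph (V : Type) [Fintype V] where
  underlying : SimpleGraph V
  snapshot : ℕ → SimpleGraph V
  snapshot_le : ∀ t, snapshot t ≤ underlying
  label : V → ℕ
  label_injective : Function.Injective label
  port : V → V → ℕ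
  port_bijOn : ∀ v, Set.BijOn (port v) (underlying.neighborSet v)
    (Set.Icc 1 (underlying.neighborSet v).ncard)

/-- What the agent receives at one time step in the `KT₀` model: the label of its current node,
the degree of this node in the underlying graph, the set of ports that are available there now, and
the incoming port (`none` at time `0`). -/
structure Observation where
  label : ℕ
  degree : ℕ
  ports : Finset ℕ
  inPort : Option ℕ

/-- A deterministic algorithm: from the list of all observations made so far (in chronological
order) it computes its next action, `some p` (leave through port `p`) or `none` (terminate). -/
abbrev Algorithm := List Observation → Option ℕ

namespace DynGraph

variable {V : Type} [Fintype V] (𝒢 : DynGraph V)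

/-- For `T ≥ 1`: in every window of `T` consecutive times, the edges that are present
throughout the window form a connected spanning graph. -/
def IntervalConnected (T : ℕ) : Prop :=
  ∀ t : ℕ, (⨅ i : Fin T, 𝒢.snapshot (t + i)).Connected

/-- The number of edges of the underlying graph. -/
noncomputable def numEdges : ℕ := 𝒢.underlying.edgeSet.ncard

open Classical in
/-- The set of ports available at node `v` at time `t`. -/
noncomputable def availablePorts (v : V) (t : ℕ) : Finset ℕ :=
  (Finset.univ.filter fun u => (𝒢.snapshot t).Adj v u).image (𝒢.port v)

/-- The observation at time `t` of an agent whose position at each time `i` is `ν i`. -/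
noncomputable def observation (ν : ℕ → V) (t : ℕ) : Observation where
  label := 𝒢.label (ν t)
  degree := (𝒢.underlying.neighborSet (ν t)).ncard
  ports := 𝒢.availablePorts (ν t) t
  inPort := if t = 0 then none else some (𝒢.port (ν t) (ν (t - 1)))

/-- The observations at times `0, 1, …, t`. -/
noncomputable def history (ν : ℕ → V) (t : ℕ) : List Observation :=
  (List.range (t + 1)).map (𝒢.observation ν)

/-- At time `t` the algorithm `A` moves the agent from `ν t` to `ν (t + 1)`, along an edge that is
present at time `t`. -/
def Moves (A : Algorithm) (ν : ℕ → V) (t : ℕ) : Prop :=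
  (𝒢.snapshot t).Adj (ν t) (ν (t + 1)) ∧
    A (𝒢.history ν t) = some (𝒢.port (ν t) (ν (t + 1)))

/-- An agent that runs `A` from `v₀` moves at each of the times `0, …, s - 1`, terminates at
time `s`, and has then visited every node. (Only `ν 0, …, ν s` matter, and they are
determined by `A` and `v₀`.) -/
def ExploresInTime (A : Algorithm) (v₀ : V) (s : ℕ) : Prop :=
  ∃ ν : ℕ → V, ν 0 = v₀ ∧ (∀ t < s, 𝒢.Moves A ν t) ∧ A (𝒢.history ν s) = none ∧
    ∀ v, ∃ t ≤ s, ν t = v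

end DynGraph

/-! The agent divides time into windows. Within a window it trusts a traversed edge as long as the
edge was present at all visits to its endpoints. It takes a fresh edge if there is one at its node,
and otherwise follows a shortest trusted path to a target. If no target is reachable, it stops. This
is correct when the window is no longer than the connectivity interval: the edges present throughout
the window then connect all nodes, and starting from the agent each of them has been traversed,
since an untraversed one would create a target (`forall_visited_of_not_reachesTarget`).

To bound a window, join all targets to an apex and consider the agent's distance to it. A pursuit
step lowers this distance by one. Seeing an edge missing, or exhausting a target, deletes an edge,
which raises a finite distance by at most the distance of the endpoints after the deletion. For
every order of deletions these costs add up to at most `deletionBudget` (`DeletionCosts.sum_le`):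
the deleted edges of cost at least `2 * r + 2`, together with a spanning tree, have no cycle of
length at most `2 * r + 2`, so growing balls as in the Moore bound leaves at most `N * (N ^ (1 / r)
- 1) + 1` of them on `N` vertices. Summation over `r` gives `O(ε m + n log² n)`
(`deletionBudget_le`).

A fresh edge to a new node costs a constant, and one to a known node costs `O(n)` but closes a
cycle. Hence a window much longer than its budget must have closed cycles that pay for it
(`window_length_le`). The agent can compute the budget from what it has seen, so it opens a new
window whenever the current one is too long, without knowing `n`, `m` or `T`. At most `m - n + 1`
cycles are closed in all, and only the last window is paid for by the budget itself. -/

/-! ### Graphs without short cycles have few edges -/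

section LongDetours

variable {W : Type*}

/-- Every walk that avoids an edge of `H` but joins its endpoints has length at least `L`. -/
def HasLongDetours (H : SimpleGraph W) (L : ℕ) : Prop :=
  ∀ ⦃a b : W⦄, H.Adj a b → ∀ p : H.Walk a b, s(a, b) ∉ p.edges → L ≤ p.length

theorem HasLongDetours.mono {H K : SimpleGraph W} {L : ℕ} (hK : HasLongDetours K L) (h : H ≤ K) :
    HasLongDetours H L := by
  intro a b hab p hp
  have := hK (h hab) (p.mapLe h) (by rwa [SimpleGraph.Walk.edges_mapLe_eq_edges])
  rwa [SimpleGraph.Walk.length_mapLe] at this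

/-- In a graph with long detours, a vertex near `v` has at most one neighbour that is no farther
from `v`. -/
theorem HasLongDetours.unique_parent {H : SimpleGraph W} {r : ℕ}
    (hH : HasLongDetours H (2 * r + 2)) {v z u u' : W} (hz : H.dist v z ≤ r)
    (hzr : H.Reachable v z) (hu : H.Adj u z) (hu' : H.Adj u' z)
    (hd : H.dist v u ≤ H.dist v z) (hd' : H.dist v u' ≤ H.dist v z) : u = u' := by
  classical
  by_contra hne
  have key : ∀ {w : W}, H.Adj w z → H.dist v w ≤ H.dist v z →
      ∃ p : H.Walk v w, p.length = H.dist v w ∧ z ∉ p.support := by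
    intro w hw hdw
    obtain ⟨p, hp⟩ := (hzr.trans hw.symm.reachable).exists_walk_length_eq_dist
    refine ⟨p, hp, fun hzp => ?_⟩
    have h1 := SimpleGraph.dist_le (p.takeUntil z hzp)
    have h2 : 0 < (p.dropUntil z hzp).length := by
      rw [Nat.pos_iff_ne_zero]
      intro h0
      exact hw.ne (SimpleGraph.Walk.eq_of_length_eq_zero h0).symm
    have h3 := congrArg SimpleGraph.Walk.length (p.take_spec hzp)
    rw [SimpleGraph.Walk.length_append] at h3
    omega
  obtain ⟨p, hp, hzp⟩ := key hu hd
  obtain ⟨p', hp', hzp'⟩ := key hu' hd'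
  -- From `z` through `u` and `v` to `u'` there are at most `2 * r + 1` steps, and the edge from `z`
  -- to `u'` is avoided.
  have := hH hu'.symm (SimpleGraph.Walk.cons hu.symm (p.reverse.append p')) (by
    simp only [SimpleGraph.Walk.edges_cons, SimpleGraph.Walk.edges_append,
      SimpleGraph.Walk.edges_reverse, List.mem_cons, List.mem_append, List.mem_reverse, not_or]
    refine ⟨fun h => hne ?_, fun h => hzp (p.fst_mem_support_of_mem_edges h),
      fun h => hzp' (p'.fst_mem_support_of_mem_edges h)⟩
    simpa [hu'.ne', hu.ne'] using h.symm)
  simp only [SimpleGraph.Walk.length_cons, SimpleGraph.Walk.length_append,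
    SimpleGraph.Walk.length_reverse] at this
  omega

/-- Otherwise `b` grows by a factor above `β` in each of `r` steps and ends above `β ^ r`. -/
theorem exists_slow_growth {r : ℕ} {β : ℝ} (hβ : 0 ≤ β) {N : ℝ} (hN : N ≤ β ^ r) (b : ℕ → ℝ)
    (h0 : 1 ≤ b 0) (hr : b r ≤ N) (hr0 : 0 < r) : ∃ i < r, b (i + 1) ≤ β * b i := by
  by_contra! hcon
  have h1 : ∀ i ≤ r, β ^ i ≤ b i := by
    intro i hi
    induction i with
    | zero => simpa using h0
    | succ k ih =>
      have := hcon k hi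
      have h2 := mul_le_mul_of_nonneg_left (ih (by omega)) hβ
      rw [pow_succ']
      linarith
  obtain ⟨k, rfl⟩ : ∃ k, r = k + 1 := ⟨r - 1, by omega⟩
  have h2 := hcon k (by omega)
  have h3 := mul_le_mul_of_nonneg_left (h1 k (by omega)) hβ
  rw [pow_succ'] at hN
  linarith

/-- A graph on at most `β ^ r` vertices without cycles of length at most `2 * r + 2` has at most
`β` edges per vertex. -/
theorem HasLongDetours.ncard_edgeSet_le [Fintype W] {r : ℕ} (hr : 0 < r) {β : ℝ} (hβ : 0 ≤ β)
    (hN : (Fintype.card W : ℝ) ≤ β ^ r) (S : Finset W) :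
    ∀ H : SimpleGraph W, (∀ a b, H.Adj a b → a ∈ S) → HasLongDetours H (2 * r + 2) →
      (H.edgeSet.ncard : ℝ) ≤ β * S.card := by
  classical
  induction S using Finset.strongInduction with
  | H S ih =>
  intro H hS hH
  rcases S.eq_empty_or_nonempty with rfl | ⟨v, hv⟩
  · have : H = ⊥ := by
      ext a b
      simpa using fun h => absurd (hS a b h) (by simp)
    simp [this]
  set B : ℕ → Finset W := fun i => S.filter fun u => H.Reachable v u ∧ H.dist v u ≤ i with hB
  have hvB : ∀ i, v ∈ B i := fun i => by simp [hB, hv]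
  -- A ball that grows by a factor of at most `β` is removed together with all edges that meet it.
  -- These number at most the size of the next ball, so the removed vertices pay for them with `β`
  -- each.
  obtain ⟨i, hir, hi⟩ := exists_slow_growth hβ hN (fun i => ((B i).card : ℝ))
    (by exact_mod_cast Finset.card_pos.2 ⟨v, hvB 0⟩) (by exact_mod_cast Finset.card_le_univ _) hr
  set E : Set (Sym2 W) := {e | e ∈ H.edgeSet ∧ ∃ u ∈ B i, u ∈ e} with hE
  have hpar : ∀ e ∈ E, ∃ z ∈ B (i + 1), ∃ u, e = s(u, z) ∧ H.Adj u z ∧ H.dist v u ≤ H.dist v z := by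
    rintro e ⟨he, u, hu, hue⟩
    obtain ⟨w, rfl⟩ := hue
    have huw : H.Adj u w := he
    simp only [hB, Finset.mem_filter] at hu
    have hrw : H.Reachable v w := hu.2.1.trans huw.reachable
    have htri : H.dist v w ≤ H.dist v u + 1 := by
      have := hu.2.1.dist_triangle_left w
      rw [SimpleGraph.dist_eq_one_iff_adj.2 huw] at this
      exact this
    rcases le_total (H.dist v u) (H.dist v w) with h | h
    · refine ⟨w, ?_, u, rfl, huw, h⟩
      simp only [hB, Finset.mem_filter]
      exact ⟨hS _ _ huw.symm, hrw, by omega⟩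
    · refine ⟨u, ?_, w, Sym2.eq_swap, huw.symm, h⟩
      simp only [hB, Finset.mem_filter]
      exact ⟨hS _ _ huw, hu.2.1, by omega⟩
  have : Nonempty W := ⟨v⟩
  choose! f hf g hg using hpar
  -- An edge is charged to its endpoint farther from `v`; by `unique_parent` no vertex is charged
  -- twice.
  have hcardE : E.ncard ≤ (B (i + 1)).card := by
    rw [← Set.ncard_coe_finset (B (i + 1))]
    refine Set.ncard_le_ncard_of_injOn f (fun e he => hf e he) ?_ (Finset.finite_toSet _)
    intro e he e' he' hee
    have hz := hf e he
    simp only [hB, Finset.mem_filter] at hz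
    obtain ⟨h1, h2, h3⟩ := hg e he
    obtain ⟨h1', h2', h3'⟩ := hg e' he'
    rw [← hee] at h1' h2' h3'
    have := hH.unique_parent (v := v) (by omega) hz.2.1 h2 h2' h3 h3'
    rw [h1, h1', this]
  set H' : SimpleGraph W :=
    { Adj := fun a b => H.Adj a b ∧ a ∉ B i ∧ b ∉ B i
      symm := ⟨fun a b h => ⟨h.1.symm, h.2.2, h.2.1⟩⟩
      loopless := ⟨fun a h => H.loopless.irrefl a h.1⟩ } with hH'
  have hle : H' ≤ H := fun a b h => h.1
  have hsub : S \ B i ⊂ S := by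
    refine Finset.ssubset_iff_subset_ne.2 ⟨Finset.sdiff_subset, fun h => ?_⟩
    have : v ∈ S \ B i := by rw [h]; exact hv
    exact (Finset.mem_sdiff.1 this).2 (hvB i)
  have hrec := ih _ hsub H' (fun a b h => Finset.mem_sdiff.2 ⟨hS a b h.1, h.2.1⟩) (hH.mono hle)
  have hcover : H.edgeSet ⊆ E ∪ H'.edgeSet := by
    intro e he
    by_cases h : ∃ u ∈ B i, u ∈ e
    · exact Or.inl ⟨he, h⟩
    · right
      push Not at h
      induction e with
      | _ a b => exact ⟨he, fun ha => h a ha (by simp), fun hb => h b hb (by simp)⟩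
  have hcard : H.edgeSet.ncard ≤ E.ncard + H'.edgeSet.ncard :=
    (Set.ncard_le_ncard hcover (Set.toFinite _)).trans (Set.ncard_union_le _ _)
  have hBS : B i ⊆ S := Finset.filter_subset _ _
  have hsd : ((S \ B i).card : ℝ) = S.card - (B i).card := by
    rw [Finset.card_sdiff_of_subset hBS, Nat.cast_sub (Finset.card_le_card hBS)]
  rw [hsd] at hrec
  have h1 : (H.edgeSet.ncard : ℝ) ≤ E.ncard + H'.edgeSet.ncard := by exact_mod_cast hcard
  have h2 : (E.ncard : ℝ) ≤ (B (i + 1)).card := by exact_mod_cast hcardE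
  nlinarith

end LongDetours

/-! ### The total cost of deleting all edges -/

section DeletionCosts

variable {W : Type*}

/-- A trail uses the edge only once, so the parts before and after it survive the deletion. -/
theorem SimpleGraph.Walk.IsTrail.exists_split_at_edge {G : SimpleGraph W} {a b x y : W}
    {p : G.Walk x y} (hp : p.IsTrail) (hab : s(a, b) ∈ p.edges) :
    ∃ c d, s(a, b) = s(c, d) ∧ ∃ (p₁ : (G.deleteEdges {s(a, b)}).Walk x c)
      (p₂ : (G.deleteEdges {s(a, b)}).Walk d y), p₁.length + 1 + p₂.length = p.length := by
  induction p with
  | nil => simp at hab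
  | @cons u v w h q ih =>
    rw [SimpleGraph.Walk.isTrail_cons] at hp
    by_cases hq : s(a, b) ∈ q.edges
    · obtain ⟨c, d, hcd, p₁, p₂, hlen⟩ := ih hp.1 hq
      have hne : s(u, v) ≠ s(a, b) := fun h => hp.2 (h ▸ hq)
      have hadj : (G.deleteEdges {s(a, b)}).Adj u v := by
        rw [SimpleGraph.deleteEdges_adj]
        exact ⟨h, hne⟩
      refine ⟨c, d, hcd, SimpleGraph.Walk.cons hadj p₁, p₂, ?_⟩
      simp only [SimpleGraph.Walk.length_cons]
      omega
    · have : s(a, b) = s(u, v) := by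
        simpa [hq] using hab
      refine ⟨u, v, this, SimpleGraph.Walk.nil, q.toDeleteEdge _ hq, ?_⟩
      simp [SimpleGraph.Walk.toDeleteEdge, SimpleGraph.Walk.toDeleteEdges]
      omega

/-- A detour for an old edge that runs through the new one closes up to a cycle with the old edge.
Cutting this cycle at the new edge instead gives a walk of the same length in `H` between `a` and
`b`. -/
theorem HasLongDetours.sup_edge {H : SimpleGraph W} {L : ℕ} (hH : HasLongDetours H L) {a b : W}
    (hab : ∀ q : H.Walk a b, L ≤ q.length) : HasLongDetours (H ⊔ SimpleGraph.edge a b) L := by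
  classical
  intro c d hcd p hp
  have hle : (H ⊔ SimpleGraph.edge a b).deleteEdges {s(a, b)} ≤ H := by
    intro u v huv
    rw [SimpleGraph.deleteEdges_adj, SimpleGraph.sup_adj] at huv
    rcases huv with ⟨h | h, h'⟩
    · exact h
    · rw [SimpleGraph.edge_adj] at h
      exact absurd (by simpa [Sym2.eq_iff] using h.1) h'
  have hab' : ∀ q : H.Walk b a, L ≤ q.length := fun q => by simpa using hab q.reverse
  have hpb : L ≤ p.bypass.length := by
    have hpe : s(c, d) ∉ p.bypass.edges := fun h => hp (p.edges_bypass_subset_edges h)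
    generalize hq : p.bypass = q at hpe
    have hqt : q.IsPath := hq ▸ p.bypass_isPath
    by_cases hu : s(a, b) ∈ q.edges
    · have hne : s(c, d) ≠ s(a, b) := fun h => hpe (h ▸ hu)
      have hcdH : H.Adj c d := hle (by
        rw [SimpleGraph.deleteEdges_adj]
        exact ⟨hcd, hne⟩)
      obtain ⟨u, v, huv, p₁, p₂, hlen⟩ := hqt.isTrail.exists_split_at_edge hu
      have hwl : L ≤ ((p₁.mapLe hle).reverse.append
          (SimpleGraph.Walk.cons hcdH (p₂.mapLe hle).reverse)).length := by
        rcases Sym2.eq_iff.1 huv with ⟨rfl, rfl⟩ | ⟨rfl, rfl⟩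
        · exact hab _
        · exact hab' _
      simp only [SimpleGraph.Walk.length_append, SimpleGraph.Walk.length_reverse,
        SimpleGraph.Walk.length_cons, SimpleGraph.Walk.length_mapLe] at hwl
      omega
    · have hlen : ((q.toDeleteEdge _ hu).mapLe hle).length = q.length := by
        simp [SimpleGraph.Walk.toDeleteEdge, SimpleGraph.Walk.toDeleteEdges]
      by_cases hcab : s(c, d) = s(a, b)
      · rw [← hlen]
        rcases Sym2.eq_iff.1 hcab with ⟨rfl, rfl⟩ | ⟨rfl, rfl⟩
        · exact hab _
        · exact hab' _
      · have hcdH : H.Adj c d := hle (by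
          rw [SimpleGraph.deleteEdges_adj]
          exact ⟨hcd, hcab⟩)
        rw [← hlen]
        refine hH hcdH _ ?_
        simpa [SimpleGraph.Walk.toDeleteEdge, SimpleGraph.Walk.toDeleteEdges,
          SimpleGraph.Walk.edges_mapLe_eq_edges] using hpe
  exact hpb.trans (p.length_bypass_le_length)

/-- The costs of deleting all edges of a graph one by one. Deleting an edge costs the distance of
its endpoints afterwards, and nothing if they have become disconnected. -/
inductive DeletionCosts : SimpleGraph W → List ℕ → Prop
  | nil : DeletionCosts ⊥ []
  | cons {G : SimpleGraph W} {a b : W} {l : List ℕ} (hab : G.Adj a b)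
      (hl : DeletionCosts (G.deleteEdges {s(a, b)}) l) :
      DeletionCosts G ((G.deleteEdges {s(a, b)}).dist a b :: l)

theorem SimpleGraph.ncard_edgeSet_deleteEdge [Finite W] {G : SimpleGraph W} {a b : W}
    (hab : G.Adj a b) : (G.deleteEdges {s(a, b)}).edgeSet.ncard + 1 = G.edgeSet.ncard := by
  rw [SimpleGraph.edgeSet_deleteEdges]
  exact Set.ncard_sdiff_singleton_add_one hab (Set.toFinite _)

theorem DeletionCosts.length_eq [Finite W] {G : SimpleGraph W} {l : List ℕ}
    (h : DeletionCosts G l) : l.length = G.edgeSet.ncard := by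
  induction h with
  | nil => simp
  | cons hab _ ih => rw [List.length_cons, ih, SimpleGraph.ncard_edgeSet_deleteEdge hab]

theorem SimpleGraph.dist_lt_fintypeCard [Fintype W] (G : SimpleGraph W) (a b : W) :
    G.dist a b < Fintype.card W := by
  by_cases h : G.Reachable a b
  · obtain ⟨p, hp, hlen⟩ := h.exists_path_of_dist
    rw [← hlen]
    exact hp.length_lt
  · rw [SimpleGraph.dist_eq_zero_of_not_reachable h]
    exact Fintype.card_pos_iff.2 ⟨a⟩

theorem DeletionCosts.lt_card [Fintype W] {G : SimpleGraph W} {l : List ℕ}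
    (h : DeletionCosts G l) : ∀ d ∈ l, d < Fintype.card W := by
  induction h with
  | nil => simp
  | cons hab _ ih =>
    intro d hd
    rcases List.mem_cons.1 hd with rfl | hd
    · exact SimpleGraph.dist_lt_fintypeCard _ _ _
    · exact ih d hd

theorem SimpleGraph.reachable_of_forall_adj {G H : SimpleGraph W}
    (h : ∀ a b, G.Adj a b → H.Reachable a b) {x y : W} (hxy : G.Reachable x y) :
    H.Reachable x y := by
  obtain ⟨p⟩ := hxy
  induction p with
  | nil => rfl
  | cons hab _ ih => exact (h _ _ hab).trans ih

/-- The deleted edges of cost at least `L` extend a spanning forest to a graph with long detours. -/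
theorem DeletionCosts.exists_hasLongDetours [Finite W] {G : SimpleGraph W} {l : List ℕ}
    (h : DeletionCosts G l) {L : ℕ} (hL : 0 < L) :
    ∃ (H : SimpleGraph W) (F : Set (Sym2 W)), H ≤ G ∧ F ⊆ H.edgeSet ∧ HasLongDetours H L ∧
      (∀ u v, G.Reachable u v → (H.deleteEdges F).Reachable u v) ∧
      F.ncard = (l.filter (L ≤ ·)).length := by
  induction h with
  | nil =>
    refine ⟨⊥, ∅, le_rfl, by simp, fun a b h => absurd h (by simp), fun u v h => ?_, by simp⟩
    simpa using h
  | @cons G a b l hab _ ih =>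
    obtain ⟨H, F, hHG, hFH, hH, hreach, hcard⟩ := ih
    have hle : G.deleteEdges {s(a, b)} ≤ G := SimpleGraph.deleteEdges_le _
    have habF : s(a, b) ∉ F := fun hF => by
      have := hHG (show H.Adj a b from hFH hF)
      simp [SimpleGraph.deleteEdges_adj] at this
    have hedge : SimpleGraph.edge a b ≤ G := by
      intro u v huv
      rw [SimpleGraph.edge_adj] at huv
      rcases huv.1 with ⟨rfl, rfl⟩ | ⟨rfl, rfl⟩
      · exact hab
      · exact hab.symm
    have hreach' : (G.deleteEdges {s(a, b)}).Reachable a b →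
        ∀ u v, G.Reachable u v → (H.deleteEdges F).Reachable u v := by
      intro hr u v huv
      refine hreach u v (SimpleGraph.reachable_of_forall_adj (fun c d hcd => ?_) huv)
      by_cases he : s(c, d) = s(a, b)
      · rcases Sym2.eq_iff.1 he with ⟨rfl, rfl⟩ | ⟨rfl, rfl⟩
        · exact hr
        · exact hr.symm
      · refine SimpleGraph.Adj.reachable ?_
        rw [SimpleGraph.deleteEdges_adj]
        exact ⟨hcd, he⟩
    -- An expensive edge joins both `H` and `F`, a cheap one is dropped, and a bridge joins `H`
    -- only, because `H` without `F` needs it for connectivity.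
    by_cases hr : (G.deleteEdges {s(a, b)}).Reachable a b
    · by_cases hd : L ≤ (G.deleteEdges {s(a, b)}).dist a b
      · refine ⟨H ⊔ SimpleGraph.edge a b, insert s(a, b) F, sup_le (hHG.trans hle) hedge, ?_,
          hH.sup_edge fun q => ?_, fun u v huv => ?_, ?_⟩
        · rw [SimpleGraph.edgeSet_sup]
          refine Set.insert_subset (Or.inr ?_) (hFH.trans Set.subset_union_left)
          simp [hab.ne]
        · have := SimpleGraph.dist_le (q.mapLe hHG)
          rw [SimpleGraph.Walk.length_mapLe] at this
          omega
        · refine (hreach' hr u v huv).mono ?_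
          intro c d hcd
          rw [SimpleGraph.deleteEdges_adj] at hcd ⊢
          refine ⟨Or.inl hcd.1, fun hmem => ?_⟩
          rcases hmem with hmem | hmem
          · have := hHG hcd.1
            rw [SimpleGraph.deleteEdges_adj] at this
            exact this.2 hmem
          · exact hcd.2 hmem
        · rw [Set.ncard_insert_of_notMem habF (Set.toFinite _), hcard]
          simp [hd]
      · refine ⟨H, F, hHG.trans hle, hFH, hH, hreach' hr, ?_⟩
        rw [hcard]
        simp [hd]
    · refine ⟨H ⊔ SimpleGraph.edge a b, F, sup_le (hHG.trans hle) hedge,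
        ?_, hH.sup_edge fun q => absurd (q.mapLe hHG).reachable hr, fun u v huv => ?_, ?_⟩
      · rw [SimpleGraph.edgeSet_sup]
        exact hFH.trans Set.subset_union_left
      · refine SimpleGraph.reachable_of_forall_adj (fun c d hcd => ?_) huv
        by_cases he : s(c, d) = s(a, b)
        · refine SimpleGraph.Adj.reachable ?_
          rw [SimpleGraph.deleteEdges_adj, he]
          refine ⟨Or.inr ?_, habF⟩
          rw [SimpleGraph.edge_adj]
          exact ⟨by simpa [Sym2.eq_iff] using he, hcd.ne⟩
        · refine (hreach c d (SimpleGraph.Adj.reachable ?_)).mono ?_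
          · rw [SimpleGraph.deleteEdges_adj]
            exact ⟨hcd, he⟩
          · exact SimpleGraph.deleteEdges_mono le_sup_left
      · rw [hcard, SimpleGraph.dist_eq_zero_of_not_reachable hr]
        simp [hL.ne']

/-- `H` has at most `β` edges per vertex, and without the expensive edges `F` it is still connected,
which takes all but one edge per vertex up to the last. -/
theorem DeletionCosts.length_filter_le [Fintype W] {G : SimpleGraph W} {l : List ℕ}
    (h : DeletionCosts G l) (hG : G.Connected) {r : ℕ} (hr : 0 < r) {β : ℝ} (hβ : 0 ≤ β)
    (hN : (Fintype.card W : ℝ) ≤ β ^ r) :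
    ((l.filter (2 * r + 2 ≤ ·)).length : ℝ) ≤ Fintype.card W * (β - 1) + 1 := by
  obtain ⟨H, F, -, hFH, hH, hreach, hcard⟩ := h.exists_hasLongDetours (L := 2 * r + 2) (by omega)
  have hub := HasLongDetours.ncard_edgeSet_le hr hβ hN Finset.univ H
    (fun _ _ _ => Finset.mem_univ _) hH
  have hconn : (H.deleteEdges F).Connected :=
    { preconnected := fun u v => hreach u v (hG.preconnected u v), nonempty := hG.nonempty }
  have hlb := hconn.card_vert_le_card_edgeSet_add_one
  rw [Nat.card_coe_set_eq, SimpleGraph.edgeSet_deleteEdges, Nat.card_eq_fintype_card] at hlb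
  have hsum := Set.ncard_sdiff_add_ncard_of_subset hFH (Set.toFinite _)
  rw [← hcard]
  rw [Finset.card_univ] at hub
  have h1 : ((H.edgeSet \ F).ncard : ℝ) + F.ncard = H.edgeSet.ncard := by exact_mod_cast hsum
  have h2 : (Fintype.card W : ℝ) ≤ (H.edgeSet \ F).ncard + 1 := by exact_mod_cast hlb
  linarith

/-- A shortest path uses the edge at most once, and that use can be replaced by a shortest detour.
-/
theorem SimpleGraph.dist_deleteEdge_le {G : SimpleGraph W} {a b x y : W}
    (hxy : (G.deleteEdges {s(a, b)}).Reachable x y) :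
    (G.deleteEdges {s(a, b)}).dist x y ≤ G.dist x y + (G.deleteEdges {s(a, b)}).dist a b := by
  obtain ⟨p, hp, hlen⟩ := (hxy.mono (SimpleGraph.deleteEdges_le _)).exists_path_of_dist
  by_cases hu : s(a, b) ∈ p.edges
  · obtain ⟨c, d, hcd, p₁, p₂, hl⟩ := hp.isTrail.exists_split_at_edge hu
    have hr : (G.deleteEdges {s(a, b)}).Reachable c d :=
      p₁.reachable.symm.trans (hxy.trans p₂.reachable.symm)
    have hdist : (G.deleteEdges {s(a, b)}).dist c d = (G.deleteEdges {s(a, b)}).dist a b := by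
      rcases Sym2.eq_iff.1 hcd with ⟨rfl, rfl⟩ | ⟨rfl, rfl⟩
      · rfl
      · exact SimpleGraph.dist_comm
    obtain ⟨q, hq⟩ := hr.exists_walk_length_eq_dist
    have := SimpleGraph.dist_le (p₁.append (q.append p₂))
    simp only [SimpleGraph.Walk.length_append] at this
    omega
  · have := SimpleGraph.dist_le (p.toDeleteEdge _ hu)
    simp only [SimpleGraph.Walk.toDeleteEdge, SimpleGraph.Walk.toDeleteEdges,
      SimpleGraph.Walk.length_transfer] at this
    omega

/-- Deletion costs pay for the growth of all finite distances. -/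
theorem DeletionCosts.exists_of_le [Finite W] {G' : SimpleGraph W} {l' : List ℕ}
    (h' : DeletionCosts G' l') : ∀ (k : ℕ) (G : SimpleGraph W), G' ≤ G →
      G.edgeSet.ncard = G'.edgeSet.ncard + k →
      ∃ l, DeletionCosts G l ∧
        ∀ x y, G'.Reachable x y → G'.dist x y + l'.sum ≤ G.dist x y + l.sum := by
  intro k
  induction k with
  | zero =>
    intro G hle hcard
    have : G' = G := by
      rw [← SimpleGraph.edgeSet_inj]
      exact Set.eq_of_subset_of_ncard_le (SimpleGraph.edgeSet_subset_edgeSet.2 hle) (by omega)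
        (Set.toFinite _)
    subst this
    exact ⟨l', h', fun x y _ => le_rfl⟩
  | succ k ih =>
    intro G hle hcard
    obtain ⟨e, he, he'⟩ := Set.exists_mem_notMem_of_ncard_lt_ncard
      (s := G'.edgeSet) (t := G.edgeSet) (by omega) (Set.toFinite _)
    induction e with
    | _ a b =>
      have hab : G.Adj a b := he
      have hle' : G' ≤ G.deleteEdges {s(a, b)} := by
        intro c d hcd
        rw [SimpleGraph.deleteEdges_adj]
        refine ⟨hle hcd, fun h => he' ?_⟩
        rw [Set.mem_singleton_iff] at h
        rw [← h]
        exact hcd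
      have hc := SimpleGraph.ncard_edgeSet_deleteEdge hab
      obtain ⟨l, hl, hsum⟩ := ih _ hle' (by omega)
      refine ⟨_, DeletionCosts.cons hab hl, fun x y hxy => ?_⟩
      have h1 := hsum x y hxy
      have h2 := SimpleGraph.dist_deleteEdge_le (hxy.mono hle')
      rw [List.sum_cons]
      omega

theorem DeletionCosts.exists_list [Finite W] (G : SimpleGraph W) : ∃ l, DeletionCosts G l := by
  obtain ⟨l, hl, -⟩ := (DeletionCosts.nil (W := W)).exists_of_le G.edgeSet.ncard G bot_le (by simp)
  exact ⟨l, hl⟩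

/-- Summation by levels: each `d` is at most 3 plus twice the number of `r ≥ 1` with `2 * r + 2 ≤
d`. -/
theorem List.sum_le_sum_length_filter (l : List ℕ) (R : ℕ) (h : ∀ d ∈ l, d ≤ 2 * R + 3) :
    l.sum ≤ 3 * l.length + 2 * ∑ r ∈ Finset.Icc 1 R, (l.filter (2 * r + 2 ≤ ·)).length := by
  induction l with
  | nil => simp
  | cons d l ih =>
    have ih' := ih fun e he => h e (by simp [he])
    have hd := h d (by simp)
    have hcount : d ≤ 3 + 2 * ∑ r ∈ Finset.Icc 1 R, if 2 * r + 2 ≤ d then 1 else 0 := by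
      rw [Finset.sum_ite, Finset.sum_const_zero, Finset.sum_const, smul_eq_mul, mul_one, add_zero]
      have : Finset.Icc 1 (d / 2 - 1) ⊆ (Finset.Icc 1 R).filter fun r => 2 * r + 2 ≤ d := by
        intro r hr
        simp only [Finset.mem_Icc, Finset.mem_filter] at hr ⊢
        omega
      have := Finset.card_le_card this
      rw [Nat.card_Icc] at this
      omega
    have hsplit : ∀ r, ((d :: l).filter (2 * r + 2 ≤ ·)).length =
        (if 2 * r + 2 ≤ d then 1 else 0) + (l.filter (2 * r + 2 ≤ ·)).length := by
      intro r
      by_cases hr : 2 * r + 2 ≤ d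
      · simp [hr]; omega
      · simp [hr]
    simp only [hsplit, Finset.sum_add_distrib, List.sum_cons, List.length_cons]
    omega

/-- A bound for the total deletion cost of a connected graph with `N` vertices and `M` edges. -/
noncomputable def deletionBudget (N M : ℕ) : ℕ :=
  3 * M + 2 * ∑ r ∈ Finset.Icc 1 N, min M ⌊(N : ℝ) * ((N : ℝ) ^ ((r : ℝ)⁻¹) - 1) + 1⌋₊

/-- At level `r` the girth bound is used with `β = N ^ (1 / r)`, the least value it admits. -/
theorem DeletionCosts.sum_le [Fintype W] {G : SimpleGraph W} {l : List ℕ}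
    (h : DeletionCosts G l) (hG : G.Connected) :
    l.sum ≤ deletionBudget (Fintype.card W) G.edgeSet.ncard := by
  refine (l.sum_le_sum_length_filter (Fintype.card W) fun d hd => ?_).trans ?_
  · have := h.lt_card d hd
    omega
  rw [h.length_eq, deletionBudget]
  gcongr with r hr
  have hr1 : 0 < r := (Finset.mem_Icc.1 hr).1
  refine le_min ((List.length_filter_le _ _).trans h.length_eq.le) (Nat.le_floor ?_)
  refine h.length_filter_le hG hr1 (by positivity) ?_
  rw [← Real.rpow_natCast, ← Real.rpow_mul (by positivity),
    inv_mul_cancel₀ (by positivity), Real.rpow_one]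

theorem deletionBudget_mono {N N' M M' : ℕ} (hN0 : 0 < N) (hN : N ≤ N') (hM : M ≤ M') :
    deletionBudget N M ≤ deletionBudget N' M' := by
  unfold deletionBudget
  have h1 : (1 : ℝ) ≤ N := by exact_mod_cast hN0
  have h2 : (N : ℝ) ≤ N' := by exact_mod_cast hN
  have hterm : ∀ r : ℕ, min M ⌊(N : ℝ) * ((N : ℝ) ^ ((r : ℝ)⁻¹) - 1) + 1⌋₊ ≤
      min M' ⌊(N' : ℝ) * ((N' : ℝ) ^ ((r : ℝ)⁻¹) - 1) + 1⌋₊ := by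
    intro r
    have h3 : (1 : ℝ) ≤ (N : ℝ) ^ ((r : ℝ)⁻¹) := Real.one_le_rpow h1 (by positivity)
    gcongr
  gcongr 3 * ?_ + 2 * ?_
  exact (Finset.sum_le_sum fun r _ => hterm r).trans
    (Finset.sum_le_sum_of_subset (Finset.Icc_subset_Icc le_rfl hN))

end DeletionCosts

/-! ### Asymptotics of the deletion budget -/

section BudgetEstimates

/-- This turns the exponential size of a level into a square that can be summed. The square root of
the claim follows from `1 + x ≤ exp x` at `x = (Y - y) / 2`. -/
theorem Real.exp_le_four_mul_exp_mul_sq {y Y : ℝ} (hy : 1 ≤ y) (hyY : y ≤ Y) :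
    Real.exp y ≤ 4 * Real.exp Y * (y / Y) ^ 2 := by
  have hY : 0 < Y := by linarith
  have h1 : (Y - y) / 2 + 1 ≤ Real.exp ((Y - y) / 2) := Real.add_one_le_exp _
  have h2 : Y ≤ 2 * y * Real.exp ((Y - y) / 2) := by nlinarith
  have h3 : Real.exp ((Y - y) / 2) ^ 2 * Real.exp y = Real.exp Y := by
    rw [← Real.exp_nat_mul, ← Real.exp_add]
    congr 1
    push_cast
    ring
  have h4 : Y ^ 2 ≤ (2 * y * Real.exp ((Y - y) / 2)) ^ 2 := by gcongr
  rw [div_pow, mul_div_assoc', le_div_iff₀ (by positivity), ← h3]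
  have h5 := mul_le_mul_of_nonneg_left h4 (Real.exp_pos y).le
  calc Real.exp y * Y ^ 2 ≤ Real.exp y * (2 * y * Real.exp ((Y - y) / 2)) ^ 2 := h5
    _ = _ := by ring

theorem Real.exp_sub_one_le_two_mul {y : ℝ} (hy : 0 ≤ y) (hy1 : y ≤ 1) :
    Real.exp y - 1 ≤ 2 * y := by
  have h := Real.abs_exp_sub_one_le (x := y) (by rwa [abs_of_nonneg hy])
  rw [abs_of_nonneg hy] at h
  exact (le_abs_self _).trans h

/-- The sum is dominated by the telescoping differences of `ρ ^ 2 / (ρ + r)`. -/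
theorem sum_sq_div_add_sq_le {ρ : ℝ} (hρ : 0 < ρ) (N : ℕ) :
    ∑ r ∈ Finset.Icc 1 N, ρ ^ 2 / (ρ + r) ^ 2 ≤ ρ := by
  have key : ∀ N : ℕ, ∑ r ∈ Finset.Icc 1 N, ρ ^ 2 / (ρ + r) ^ 2 ≤ ρ - ρ ^ 2 / (ρ + N) := by
    intro N
    induction N with
    | zero => simp [pow_two]
    | succ k ih =>
      rw [Finset.sum_Icc_succ_top (by omega)]
      have h1 : ρ ^ 2 / (ρ + (k + 1 : ℕ)) ^ 2 ≤ ρ ^ 2 / (ρ + k) - ρ ^ 2 / (ρ + (k + 1 : ℕ)) := by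
        push_cast
        have : 0 < ρ + k := by positivity
        rw [div_sub_div _ _ (by positivity) (by positivity), div_le_div_iff₀ (by positivity)
          (by positivity)]
        have h2 : ρ ^ 2 * ((ρ + k) * (ρ + (k + 1))) ≤ ρ ^ 2 * (ρ + (k + 1)) ^ 2 := by
          gcongr
          nlinarith
        calc _ ≤ _ := h2
          _ = _ := by ring
      linarith
  have : 0 ≤ ρ ^ 2 / (ρ + N) := by positivity
  linarith [key N]

theorem sum_Icc_inv_le (N : ℕ) : ∑ r ∈ Finset.Icc 1 N, (1 : ℝ) / r ≤ 1 + Real.log N := by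
  have h := harmonic_le_one_add_log N
  rw [harmonic_eq_sum_Icc] at h
  push_cast at h
  simpa using h

/-- A level of the deletion budget, in terms of `ρ = log N / (1 + log m - log n)`. -/
theorem budget_level_le {N n m Y ρ : ℝ} {r : ℕ} (hr : 0 < r) (hn : 0 < n) (hN1 : 1 < N)
    (hN : N ≤ 2 * n) (hm : 0 < m) (hY : 1 ≤ Y) (hYexp : Real.exp Y = Real.exp 1 * m / n)
    (hρ : ρ * Y = Real.log N) :
    min (2 * m) (N * (N ^ ((r : ℝ)⁻¹) - 1) + 1) ≤
      96 * m * (ρ ^ 2 / (ρ + r) ^ 2) + 2 * N * Real.log N * (1 / r) + 1 := by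
  have hr' : (0 : ℝ) < r := by exact_mod_cast hr
  have hlog : 0 < Real.log N := Real.log_pos hN1
  have hρ0 : 0 < ρ := by
    by_contra! h
    nlinarith
  have hpow : N ^ ((r : ℝ)⁻¹) = Real.exp (Real.log N / r) := by
    rw [Real.rpow_def_of_pos (by linarith), div_eq_mul_inv]
  have hnn1 : 0 ≤ 96 * m * (ρ ^ 2 / (ρ + r) ^ 2) := by positivity
  have hnn2 : 0 ≤ 2 * N * Real.log N * (1 / r) := by positivity
  -- For `r ≥ log N`, the power `N ^ (1 / r)` exceeds 1 by at most `2 * log N / r`; these levels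
  -- form the harmonic part.
  rcases le_or_gt (Real.log N) r with h1 | h1
  · refine (min_le_right _ _).trans ?_
    have h2 := Real.exp_sub_one_le_two_mul (y := Real.log N / r) (by positivity)
      ((div_le_one hr').2 h1)
    rw [hpow]
    have h3 := mul_le_mul_of_nonneg_left h2 (by linarith : 0 ≤ N)
    have h4 : N * (2 * (Real.log N / r)) = 2 * N * Real.log N * (1 / r) := by ring
    linarith
  -- For `r < ρ` the trivial bound `2 * m` suffices. For `ρ ≤ r < log N`, the exponent `log N / r`
  -- lies between 1 and `Y`, and `exp Y < 3 * m / n` with `N ≤ 2 * n` yields `24 * m * (ρ / r) ^ 2`;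
  -- replacing `r` by `ρ + r` costs a factor 4, hence 96.
  rcases lt_or_ge (r : ℝ) ρ with h2 | h2
  · refine (min_le_left _ _).trans ?_
    have h3 : (1 : ℝ) / 4 ≤ ρ ^ 2 / (ρ + r) ^ 2 := by
      rw [div_le_div_iff₀ (by norm_num) (by positivity)]
      nlinarith
    have h4 := mul_le_mul_of_nonneg_left h3 (by positivity : 0 ≤ 96 * m)
    linarith
  · refine (min_le_right _ _).trans ?_
    have hy1 : 1 ≤ Real.log N / r := by
      rw [le_div_iff₀ hr']
      linarith
    have hyY : Real.log N / r ≤ Y := by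
      rw [div_le_iff₀ hr']
      nlinarith
    have h3 := Real.exp_le_four_mul_exp_mul_sq hy1 hyY
    have h4 : Real.log N / r / Y = ρ / r := by
      rw [← hρ]
      field_simp
    rw [h4, hYexp] at h3
    rw [hpow]
    have h5 : (ρ / r) ^ 2 ≤ 4 * (ρ ^ 2 / (ρ + r) ^ 2) := by
      rw [div_pow, mul_div_assoc', div_le_div_iff₀ (by positivity) (by positivity)]
      have : (ρ + r) ^ 2 ≤ 4 * r ^ 2 := by nlinarith
      nlinarith [mul_le_mul_of_nonneg_left this (sq_nonneg ρ)]
    have h6 : N * Real.exp (Real.log N / r) ≤ 24 * m * (ρ / r) ^ 2 := by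
      calc N * Real.exp (Real.log N / r) ≤ (2 * n) * (4 * (3 * m / n) * (ρ / r) ^ 2) := by
            gcongr
            refine h3.trans ?_
            gcongr
            exact Real.exp_one_lt_three.le
        _ = _ := by
          field_simp
          ring
    have h7 : 24 * m * (ρ / r) ^ 2 ≤ 96 * m * (ρ ^ 2 / (ρ + r) ^ 2) := by
      have := mul_le_mul_of_nonneg_left h5 (by positivity : 0 ≤ 24 * m)
      linarith
    nlinarith

theorem one_le_log_of_three_le {n : ℕ} (hn : 3 ≤ n) : 1 ≤ Real.log n := by
  rw [Real.le_log_iff_exp_le (by positivity)]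
  have : (3 : ℝ) ≤ n := by exact_mod_cast hn
  linarith [Real.exp_one_lt_three]

theorem log_le_logb_two {n : ℕ} (hn : 3 ≤ n) : Real.log n ≤ Real.logb 2 n := by
  have h0 := one_le_log_of_three_le hn
  rw [Real.logb, le_div_iff₀ (Real.log_pos one_lt_two)]
  nlinarith [Real.log_two_lt_d9]

theorem explEps_le_log {n m : ℕ} (hn : 3 ≤ n) (hnm : n ≤ m) : explEps n m ≤ Real.log n := by
  have h0 := one_le_log_of_three_le hn
  have h1 : Real.log n ≤ Real.log m :=
    Real.log_le_log (by positivity) (by exact_mod_cast hnm)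
  rw [explEps, div_le_iff₀ (by linarith)]
  nlinarith

theorem half_le_explEps {n m : ℕ} (hn : 3 ≤ n) (hnm : n ≤ m) (hm : m ≤ n.choose 2) :
    1 / 2 ≤ explEps n m := by
  have h0 := one_le_log_of_three_le hn
  have h1 : Real.log n ≤ Real.log m :=
    Real.log_le_log (by positivity) (by exact_mod_cast hnm)
  have h2 : m ≤ n ^ 2 := hm.trans (Nat.choose_le_pow n 2)
  have h3 : Real.log m ≤ 2 * Real.log n := by
    have := Real.log_le_log (x := (m : ℝ)) (y := (n : ℝ) ^ 2)
      (by exact_mod_cast (by omega : 0 < m)) (by exact_mod_cast h2)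
    rwa [Real.log_pow] at this
  rw [explEps, div_le_div_iff₀ (by norm_num) (by linarith)]
  linarith

/-- The square terms sum to `96 * m * ρ` with `ρ ≤ 2 * ε`, the harmonic terms to `O(n log² n)`;
linear terms are absorbed by `ε ≥ 1 / 2` and `log n ≥ 1`. -/
theorem deletionBudget_le {n m : ℕ} (hn : 3 ≤ n) (hnm : n ≤ m) (hm : m ≤ n.choose 2) :
    (deletionBudget (n + 1) (m + n) : ℝ) ≤
      400 * (explEps n m * m + n * Real.logb 2 n ^ 2) := by
  have hlog1 := one_le_log_of_three_le hn
  have hlogb := log_le_logb_two hn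
  have heps := half_le_explEps hn hnm hm
  have hn3 : (3 : ℝ) ≤ n := by exact_mod_cast hn
  have hnm' : (n : ℝ) ≤ m := by exact_mod_cast hnm
  have hlognm : Real.log n ≤ Real.log m := Real.log_le_log (by positivity) hnm'
  set N : ℝ := (n : ℝ) + 1 with hN
  set Y : ℝ := 1 + Real.log m - Real.log n with hYdef
  have hY : 1 ≤ Y := by linarith
  have hYexp : Real.exp Y = Real.exp 1 * m / n := by
    rw [hYdef, Real.exp_sub, Real.exp_add, Real.exp_log (by linarith), Real.exp_log (by linarith)]
  have hlogN : Real.log N ≤ 2 * Real.log n := by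
    have h := Real.log_le_log (x := N) (y := (n : ℝ) ^ 2) (by positivity) (by nlinarith)
    rwa [Real.log_pow] at h
  have hlogN0 : 0 < Real.log N := Real.log_pos (by linarith)
  have hρ0 : 0 < Real.log N / Y := by positivity
  have hρ2 : Real.log N / Y ≤ 2 * explEps n m := by
    rw [explEps, mul_div_assoc']
    gcongr
  have hlevel : ∀ r ∈ Finset.Icc 1 (n + 1),
      ((min (m + n) ⌊((n + 1 : ℕ) : ℝ) * (((n + 1 : ℕ) : ℝ) ^ ((r : ℝ)⁻¹) - 1) + 1⌋₊ : ℕ) : ℝ) ≤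
        96 * m * ((Real.log N / Y) ^ 2 / (Real.log N / Y + r) ^ 2) +
          2 * N * Real.log N * (1 / r) + 1 := by
    intro r hr
    have hr0 : 0 < r := (Finset.mem_Icc.1 hr).1
    refine le_trans ?_ (budget_level_le hr0 (by linarith : (0 : ℝ) < n) (by linarith : 1 < N)
      (by linarith) (by linarith : (0 : ℝ) < m) hY hYexp (div_mul_cancel₀ _ (by linarith)))
    rw [Nat.cast_min]
    have h1 : (1 : ℝ) ≤ N ^ ((r : ℝ)⁻¹) := Real.one_le_rpow (by linarith) (by positivity)
    refine min_le_min (by push_cast; linarith) ?_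
    push_cast
    exact Nat.floor_le (by nlinarith)
  have hsum := Finset.sum_le_sum hlevel
  rw [Finset.sum_add_distrib, Finset.sum_add_distrib, ← Finset.mul_sum, ← Finset.mul_sum,
    Finset.sum_const, Nat.card_Icc] at hsum
  have hs1 := mul_le_mul_of_nonneg_left (sum_sq_div_add_sq_le hρ0 (n + 1))
    (by positivity : (0 : ℝ) ≤ 96 * m)
  have hs2 := mul_le_mul_of_nonneg_left (sum_Icc_inv_le (n + 1))
    (by positivity : (0 : ℝ) ≤ 2 * N * Real.log N)
  have hs3 := mul_le_mul_of_nonneg_left hρ2 (by positivity : (0 : ℝ) ≤ 96 * m)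
  have hs4 : 2 * N * Real.log N * (1 + Real.log ((n + 1 : ℕ) : ℝ)) ≤ 24 * (n * Real.log n ^ 2) := by
    have hcast : ((n + 1 : ℕ) : ℝ) = N := by push_cast; rfl
    rw [hcast]
    calc 2 * N * Real.log N * (1 + Real.log N)
        ≤ 2 * (2 * n) * (2 * Real.log n) * (3 * Real.log n) := by
          gcongr <;> linarith
      _ = _ := by ring
  have hs5 : (n : ℝ) * Real.log n ^ 2 ≤ n * Real.logb 2 n ^ 2 := by gcongr
  have hs6 : (n : ℝ) ≤ n * Real.log n ^ 2 :=
    le_mul_of_one_le_right (by positivity) (one_le_pow₀ hlog1)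
  have hm2 : (m : ℝ) ≤ 2 * (explEps n m * m) := by nlinarith
  rw [deletionBudget]
  push_cast at hsum ⊢
  simp only [nsmul_eq_mul, mul_one] at hsum
  push_cast at hsum hs1 hs2 hs4
  linarith

end BudgetEstimates

/-! ### Pursuing a vertex in a shrinking graph -/

section Pursuit

/-- An agent that approaches `ω` in a decreasing sequence of graphs, except for the slack `w t` at
time `t`, does so for a time that the deletion budget pays for. -/
theorem pursuit_length_le {W : Type*} [Fintype W] {G : SimpleGraph W} (hG : G.Connected) (ω : W)
    (Ψ : ℕ → SimpleGraph W) (x : ℕ → W) (w : ℕ → ℕ) {a b : ℕ} (hab : a ≤ b) (hbase : Ψ a ≤ G)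
    (hmono : ∀ t, a ≤ t → t < b → Ψ (t + 1) ≤ Ψ t)
    (hreach : ∀ t, a ≤ t → t ≤ b → (Ψ t).Reachable (x t) ω)
    (hstep : ∀ t, a ≤ t → t < b →
      (Ψ t).dist (x (t + 1)) ω + 1 ≤ (Ψ t).dist (x t) ω + w t) :
    b - a ≤ Fintype.card W + deletionBudget (Fintype.card W) G.edgeSet.ncard +
      ∑ t ∈ Finset.Ico a b, w t := by
  have hle : ∀ {H K : SimpleGraph W}, H ≤ K →
      K.edgeSet.ncard = H.edgeSet.ncard + (K.edgeSet.ncard - H.edgeSet.ncard) := by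
    intro H K h
    have := Set.ncard_le_ncard (SimpleGraph.edgeSet_subset_edgeSet.2 h) (Set.toFinite _)
    omega
  -- The induction runs backwards from `b`, since a list of deletion costs is extended at its front,
  -- by earlier deletions.
  have key : ∀ k, k ≤ b - a → ∃ l, DeletionCosts (Ψ (b - k)) l ∧
      k ≤ (Ψ (b - k)).dist (x (b - k)) ω + l.sum + ∑ t ∈ Finset.Ico (b - k) b, w t := by
    intro k
    induction k with
    | zero =>
      intro _
      obtain ⟨l, hl⟩ := DeletionCosts.exists_list (Ψ (b - 0))
      exact ⟨l, hl, Nat.zero_le _⟩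
    | succ k ih =>
      intro hk
      obtain ⟨l', hl', hsum'⟩ := ih (by omega)
      obtain ⟨t, ht, ht'⟩ : ∃ t, b - (k + 1) = t ∧ b - k = t + 1 := ⟨_, rfl, by omega⟩
      rw [ht'] at hl' hsum'
      rw [ht]
      have hm := hmono t (by omega) (by omega)
      obtain ⟨l, hl, hdist⟩ := hl'.exists_of_le _ _ hm (hle hm)
      refine ⟨l, hl, ?_⟩
      have h1 := hdist _ _ (hreach (t + 1) (by omega) (by omega))
      have h2 := hstep t (by omega) (by omega)
      rw [Finset.sum_eq_sum_Ico_succ_bot (by omega)]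
      omega
  obtain ⟨l', hl', hsum'⟩ := key (b - a) le_rfl
  rw [Nat.sub_sub_self hab] at hl' hsum'
  obtain ⟨l, hl, hdist⟩ := hl'.exists_of_le _ _ hbase (hle hbase)
  have h1 := hdist _ _ (hreach a le_rfl hab)
  have h2 := hl.sum_le hG
  have h3 := G.dist_lt_fintypeCard (x a) ω
  omega

end Pursuit

/-! ### Counting nodes, edges and closed cycles; windows -/

section Counting

open Classical in
/-- The number of different nodes among the positions at times `0, …, t`. -/
noncomputable def visitCount {α : Type*} (ν : ℕ → α) (t : ℕ) : ℕ :=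
  ((Finset.range (t + 1)).image ν).card

open Classical in
/-- The number of different edges traversed before time `t`. -/
noncomputable def edgeCount {α : Type*} (ν : ℕ → α) (t : ℕ) : ℕ :=
  ((Finset.range t).image fun i => s(ν i, ν (i + 1))).card

/-- The edge between `a` and `b` has been traversed before time `t`. -/
def Traversed {α : Type*} (ν : ℕ → α) (t : ℕ) (a b : α) : Prop :=
  ∃ i < t, (ν i = a ∧ ν (i + 1) = b) ∨ (ν i = b ∧ ν (i + 1) = a)

/-- At time `t`, a new edge is traversed that leads to a node visited before. -/
def ClosesCycle {α : Type*} (ν : ℕ → α) (t : ℕ) : Prop :=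
  (∃ i ≤ t, ν i = ν (t + 1)) ∧ ¬ Traversed ν t (ν t) (ν (t + 1))

open Classical in
/-- The number of new edges between visited nodes that are traversed before time `t`. -/
noncomputable def cycleCount {α : Type*} (ν : ℕ → α) (t : ℕ) : ℕ :=
  ∑ i ∈ Finset.range t, if ClosesCycle ν i then 1 else 0

variable {α : Type*} {ν : ℕ → α}

theorem Traversed.symm {t : ℕ} {a b : α} (h : Traversed ν t a b) : Traversed ν t b a := by
  obtain ⟨i, hi, h⟩ := h
  exact ⟨i, hi, h.symm⟩

theorem Traversed.mono {t t' : ℕ} {a b : α} (h : Traversed ν t a b) (ht : t ≤ t') :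
    Traversed ν t' a b := by
  obtain ⟨i, hi, h⟩ := h
  exact ⟨i, hi.trans_le ht, h⟩

theorem Traversed.exists_left {t : ℕ} {a b : α} (h : Traversed ν t a b) : ∃ i ≤ t, ν i = a := by
  obtain ⟨i, hi, h | h⟩ := h
  · exact ⟨i, hi.le, h.1⟩
  · exact ⟨i + 1, hi, h.2⟩

theorem traversed_iff_mem_image [DecidableEq (Sym2 α)] {t : ℕ} {a b : α} :
    Traversed ν t a b ↔ s(a, b) ∈ (Finset.range t).image fun i => s(ν i, ν (i + 1)) := by
  simp [Traversed]

open Classical in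
theorem visitCount_succ (t : ℕ) :
    visitCount ν (t + 1) = visitCount ν t + if ∃ i ≤ t, ν i = ν (t + 1) then 0 else 1 := by
  rw [visitCount, visitCount, Finset.range_add_one (n := t + 1), Finset.image_insert]
  split_ifs with h
  · rw [Finset.insert_eq_of_mem, add_zero]
    obtain ⟨i, hi, h⟩ := h
    exact Finset.mem_image.2 ⟨i, by simp; omega, h⟩
  · rw [Finset.card_insert_of_notMem]
    intro hmem
    obtain ⟨i, hi, h'⟩ := Finset.mem_image.1 hmem
    exact h ⟨i, by simpa [Nat.lt_succ_iff] using hi, h'⟩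

open Classical in
theorem edgeCount_succ (t : ℕ) :
    edgeCount ν (t + 1) = edgeCount ν t + if Traversed ν t (ν t) (ν (t + 1)) then 0 else 1 := by
  rw [edgeCount, edgeCount, Finset.range_add_one, Finset.image_insert]
  split_ifs with h
  · rw [Finset.insert_eq_of_mem (traversed_iff_mem_image.1 h), add_zero]
  · rw [Finset.card_insert_of_notMem (fun h' => h (traversed_iff_mem_image.2 h'))]

theorem visitCount_mono {t t' : ℕ} (h : t ≤ t') : visitCount ν t ≤ visitCount ν t' :=
  monotone_nat_of_le_succ (fun t => by rw [visitCount_succ]; omega) h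

theorem edgeCount_mono {t t' : ℕ} (h : t ≤ t') : edgeCount ν t ≤ edgeCount ν t' :=
  monotone_nat_of_le_succ (fun t => by rw [edgeCount_succ]; omega) h

theorem cycleCount_mono {t t' : ℕ} (h : t ≤ t') : cycleCount ν t ≤ cycleCount ν t' :=
  monotone_nat_of_le_succ (fun t => by rw [cycleCount, cycleCount, Finset.sum_range_succ]; omega) h

/-- A newly traversed edge either discovers a node or closes a cycle, and no node is discovered
otherwise. -/
theorem cycleCount_add_visitCount_le (t : ℕ) :
    cycleCount ν t + visitCount ν t ≤ edgeCount ν t + 1 := by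
  classical
  induction t with
  | zero => simp [cycleCount, visitCount, edgeCount]
  | succ t ih =>
    rw [visitCount_succ, edgeCount_succ, cycleCount, Finset.sum_range_succ, ← cycleCount]
    by_cases h1 : Traversed ν t (ν t) (ν (t + 1))
    · have : ∃ i ≤ t, ν i = ν (t + 1) := h1.symm.exists_left
      simp only [ClosesCycle, h1, this, not_true_eq_false, and_false, if_true, if_false]
      omega
    · by_cases h2 : ∃ i ≤ t, ν i = ν (t + 1)
      · simp only [ClosesCycle, h1, h2, not_false_eq_true, and_true, if_true, if_false]
        omega
      · simp only [ClosesCycle, h1, h2, false_and, if_false]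
        omega

theorem visitCount_congr {β : Type*} {φ : α → β} (hφ : Function.Injective φ) {f : ℕ → β} {t : ℕ}
    (h : ∀ i ≤ t, f i = φ (ν i)) : visitCount f t = visitCount ν t := by
  classical
  rw [visitCount, visitCount, ← Finset.card_image_of_injective _ hφ, Finset.image_image]
  congr 1
  exact Finset.image_congr fun i hi => h i (by simpa [Nat.lt_succ_iff] using hi)

theorem edgeCount_congr {β : Type*} {φ : α → β} (hφ : Function.Injective φ) {f : ℕ → β} {t : ℕ}
    (h : ∀ i ≤ t, f i = φ (ν i)) : edgeCount f t = edgeCount ν t := by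
  classical
  rw [edgeCount, edgeCount, ← Finset.card_image_of_injective _ (Sym2.map.injective hφ),
    Finset.image_image]
  congr 1
  refine Finset.image_congr fun i hi => ?_
  have hi' : i < t := by simpa using hi
  simp [h i hi'.le, h (i + 1) hi']

/-- A bound for the length of a window with `n` known nodes and `m` known edges in which no cycle
is closed. -/
noncomputable def windowBudget (n m : ℕ) : ℕ := 3 * n + 1 + deletionBudget (n + 1) (m + n)

theorem windowBudget_mono {n n' m m' : ℕ} (hn : n ≤ n') (hm : m ≤ m') :
    windowBudget n m ≤ windowBudget n' m' := by
  have := deletionBudget_mono (N := n + 1) (N' := n' + 1) (M := m + n) (M' := m' + n')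
    (by omega) (by omega) (by omega)
  rw [windowBudget, windowBudget]
  omega

open Classical in
/-- The start of the window that an agent with positions `ν` considers at time `t`: a new window
starts as soon as the current one is too long in view of the known nodes and edges. -/
noncomputable def windowStart (ν : ℕ → α) : ℕ → ℕ
  | 0 => 0
  | t + 1 => if 4 * windowBudget (visitCount ν (t + 1)) (edgeCount ν (t + 1)) <
      t + 1 - windowStart ν t then t + 1 else windowStart ν t

theorem windowStart_le (t : ℕ) : windowStart ν t ≤ t := by
  induction t with
  | zero => simp [windowStart]
  | succ t ih =>
    rw [windowStart]
    split_ifs <;> omega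

theorem sub_windowStart_le (t : ℕ) :
    t - windowStart ν t ≤ 4 * windowBudget (visitCount ν t) (edgeCount ν t) := by
  cases t with
  | zero => simp
  | succ t =>
    rw [windowStart]
    split_ifs <;> omega

theorem windowStart_eq_of_le {s t : ℕ} (h : windowStart ν t ≤ s) (hst : s ≤ t) :
    windowStart ν s = windowStart ν t := by
  induction t with
  | zero =>
    obtain rfl : s = 0 := by omega
    rfl
  | succ t ih =>
    rcases hst.eq_or_lt with rfl | hlt
    · rfl
    · have hne : windowStart ν (t + 1) ≠ t + 1 := by omega
      rw [windowStart] at hne h ⊢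
      split_ifs at hne h ⊢ with hc
      · omega
      · exact ih h (by omega)

/-- With `φ` the labelling, this lets the agent compute its window from labels alone. -/
theorem windowStart_congr {β : Type*} {φ : α → β} (hφ : Function.Injective φ) {f : ℕ → β} {t : ℕ}
    (h : ∀ i ≤ t, f i = φ (ν i)) : windowStart f t = windowStart ν t := by
  induction t with
  | zero => rfl
  | succ t ih =>
    rw [windowStart, windowStart, visitCount_congr hφ h, edgeCount_congr hφ h,
      ih fun i hi => h i (by omega)]

end Counting

/-! ### Cones over the known graph -/

section Cone

/-- The graph of the symmetric relation generated by `A`, with an apex `none` adjacent to `U`. -/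
def coneGraph {α : Type*} (A : α → α → Prop) (U : α → Prop) : SimpleGraph (Option α) where
  Adj
    | some a, some b => a ≠ b ∧ A a b ∧ A b a
    | some a, none => U a
    | none, some b => U b
    | none, none => False
  symm := ⟨by
    rintro (_ | a) (_ | b) h
    · exact h
    · exact h
    · exact h
    · exact ⟨h.1.symm, h.2.2, h.2.1⟩⟩
  loopless := ⟨by
    rintro (_ | a) h
    · exact h
    · exact h.1 rfl⟩

variable {α : Type*} {A A' : α → α → Prop} {U U' : α → Prop}

theorem coneGraph_mono (hA : ∀ a b, A a b → A' a b) (hU : ∀ a, U a → U' a) :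
    coneGraph A U ≤ coneGraph A' U' := by
  rintro (_ | a) (_ | b) h
  · exact h
  · exact hU _ h
  · exact hU _ h
  · exact ⟨h.1, hA _ _ h.2.1, hA _ _ h.2.2⟩

theorem coneGraph_connected (hU : ∀ a, U a) : (coneGraph A U).Connected := by
  have h : ∀ x, (coneGraph A U).Reachable x none := by
    rintro (_ | a)
    · rfl
    · exact SimpleGraph.Adj.reachable (hU a)
  exact { preconnected := fun x y => (h x).trans (h y).symm, nonempty := ⟨none⟩ }

open Classical in
theorem ncard_edgeSet_coneGraph_le {V : Type*} (ν : ℕ → V) (t : ℕ) :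
    (coneGraph (fun a b : (Finset.range (t + 1)).image ν => Traversed ν t (a : V) b)
      fun _ => True).edgeSet.ncard ≤ edgeCount ν t + visitCount ν t := by
  set K := (Finset.range (t + 1)).image ν
  set T := (Finset.range t).image fun i => s(ν i, ν (i + 1))
  set f : V → Option K := fun v => if h : v ∈ K then some ⟨v, h⟩ else none with hf
  have hfv : ∀ a : K, f a = some a := fun a => by simp [hf]
  have hsub : (coneGraph (fun a b : K => Traversed ν t (a : V) b) fun _ => True).edgeSet ⊆
      ((T.image (Sym2.map f) ∪ K.image fun v => s(f v, none) : Finset (Sym2 (Option K))) :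
        Set (Sym2 (Option K))) := by
    intro e he
    rw [Finset.coe_union]
    induction e with
    | _ x y =>
      rcases x with _ | a <;> rcases y with _ | b
      · exact absurd he id
      · right
        refine Finset.mem_coe.2 (Finset.mem_image.2 ⟨b, b.2, ?_⟩)
        rw [hfv, Sym2.eq_swap]
      · right
        refine Finset.mem_coe.2 (Finset.mem_image.2 ⟨a, a.2, ?_⟩)
        rw [hfv]
      · left
        refine Finset.mem_coe.2 (Finset.mem_image.2
          ⟨s((a : V), b), traversed_iff_mem_image.1 he.2.1, ?_⟩)
        rw [Sym2.map_mk, hfv, hfv]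
  refine (Set.ncard_le_ncard hsub (Finset.finite_toSet _)).trans ?_
  rw [Set.ncard_coe_finset]
  exact (Finset.card_union_le _ _).trans (add_le_add Finset.card_image_le Finset.card_image_le)

end Cone

/-! ### The exploration rule and its running time -/

namespace DynGraph

variable {V : Type} [Fintype V] (𝒢 : DynGraph V) (ν : ℕ → V)

/-- At all visits to `a` from time `t₀` to time `t`, the edge between `a` and `b` was present. -/
def SeenFrom (t₀ t : ℕ) (a b : V) : Prop :=
  ∀ j, t₀ ≤ j → j ≤ t → ν j = a → (𝒢.snapshot j).Adj a b

/-- The edge from `a` to `b` is untraversed, and present at all visits to `a` in the window. -/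
def Fresh (t₀ t : ℕ) (a b : V) : Prop :=
  𝒢.underlying.Adj a b ∧ ¬ Traversed ν t a b ∧ 𝒢.SeenFrom ν t₀ t a b

/-- The node `a` has not been visited in the window, or it has a fresh edge. -/
def IsTarget (t₀ t : ℕ) (a : V) : Prop :=
  (∀ j, t₀ ≤ j → j ≤ t → ν j ≠ a) ∨ ∃ b, 𝒢.Fresh ν t₀ t a b

/-- The edge between `a` and `b` is traversed, and was never seen missing in the window. -/
def Alive (t₀ t : ℕ) (a b : V) : Prop :=
  Traversed ν t a b ∧ 𝒢.SeenFrom ν t₀ t a b ∧ 𝒢.SeenFrom ν t₀ t b a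

/-- There is a path of `d` alive edges from a node to a target. -/
def ReachesTarget (t₀ t : ℕ) : ℕ → V → Prop
  | 0, a => 𝒢.IsTarget ν t₀ t a
  | d + 1, a => ∃ b, 𝒢.Alive ν t₀ t a b ∧ ReachesTarget t₀ t d b

/-- At time `t`, the agent may go to `b`: along a fresh edge, or, if there is none, along the first
edge of a shortest alive path to a target. -/
def LegalMove (t₀ t : ℕ) (b : V) : Prop :=
  𝒢.Fresh ν t₀ t (ν t) b ∨
    ∃ d, 𝒢.Alive ν t₀ t (ν t) b ∧ 𝒢.ReachesTarget ν t₀ t d b ∧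
      ∀ d' ≤ d, ¬ 𝒢.ReachesTarget ν t₀ t d' (ν t)

variable {𝒢 ν}

theorem SeenFrom.mono {t₀ t t' : ℕ} {a b : V} (h : 𝒢.SeenFrom ν t₀ t' a b) (ht : t ≤ t') :
    𝒢.SeenFrom ν t₀ t a b := fun j h₀ hj => h j h₀ (hj.trans ht)

theorem IsTarget.mono {t₀ t t' : ℕ} {a : V} (h : 𝒢.IsTarget ν t₀ t' a) (ht : t ≤ t') :
    𝒢.IsTarget ν t₀ t a := by
  rcases h with h | ⟨b, h1, h2, h3⟩
  · exact Or.inl fun j h₀ hj => h j h₀ (hj.trans ht)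
  · exact Or.inr ⟨b, h1, fun h => h2 (h.mono ht), h3.mono ht⟩

theorem LegalMove.adj {t₀ t : ℕ} {b : V} (h : 𝒢.LegalMove ν t₀ t b) (ht : t₀ ≤ t) :
    (𝒢.snapshot t).Adj (ν t) b := by
  rcases h with h | ⟨d, h, -⟩
  · exact h.2.2 t ht le_rfl rfl
  · exact h.2.1 t ht le_rfl rfl

theorem LegalMove.exists_reachesTarget {t₀ t : ℕ} {b : V} (h : 𝒢.LegalMove ν t₀ t b) :
    ∃ d, 𝒢.ReachesTarget ν t₀ t d (ν t) := by
  rcases h with h | ⟨d, h, h', -⟩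
  · exact ⟨0, Or.inr ⟨b, h⟩⟩
  · exact ⟨d + 1, b, h, h'⟩

theorem underlying_adj_of_traversed {t : ℕ} (hν : ∀ i < t, 𝒢.underlying.Adj (ν i) (ν (i + 1)))
    {a b : V} (h : Traversed ν t a b) : 𝒢.underlying.Adj a b := by
  obtain ⟨i, hi, ⟨rfl, rfl⟩ | ⟨rfl, rfl⟩⟩ := h
  · exact hν i hi
  · exact (hν i hi).symm

variable (𝒢 ν) in
open Classical in
/-- The nodes known at time `t₁`, with the edges traversed before `t₁` that are alive at time `t`
in the window, and with an apex adjacent to the targets. -/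
def windowGraph (t₀ t₁ t : ℕ) : SimpleGraph (Option ((Finset.range (t₁ + 1)).image ν)) :=
  coneGraph (fun a b => Traversed ν t₁ (a : V) b ∧ 𝒢.SeenFrom ν t₀ t (a : V) b)
    fun a => 𝒢.IsTarget ν t₀ t (a : V)

theorem windowGraph_le {t₀ t₁ t t' : ℕ} (h : t ≤ t') :
    𝒢.windowGraph ν t₀ t₁ t' ≤ 𝒢.windowGraph ν t₀ t₁ t :=
  coneGraph_mono (fun _ _ hab => ⟨hab.1, hab.2.mono h⟩) fun _ ha => ha.mono h

section

open Classical

theorem exists_walk_of_reachesTarget {t₀ t₁ t : ℕ}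
    (hν : ∀ i < t₁, 𝒢.underlying.Adj (ν i) (ν (i + 1))) (ht : t ≤ t₁) (d : ℕ) :
    ∀ a : (Finset.range (t₁ + 1)).image ν, 𝒢.ReachesTarget ν t₀ t d a →
      ∃ p : (𝒢.windowGraph ν t₀ t₁ t).Walk (some a) none, p.length = d + 1 := by
  induction d with
  | zero =>
    intro a ha
    have hadj : (𝒢.windowGraph ν t₀ t₁ t).Adj (some a) none := ha
    exact ⟨SimpleGraph.Walk.cons hadj SimpleGraph.Walk.nil, rfl⟩
  | succ d ih =>
    rintro a ⟨b, hab, hb⟩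
    obtain ⟨i, hi, rfl⟩ := hab.1.symm.exists_left
    have hmem : ν i ∈ (Finset.range (t₁ + 1)).image ν :=
      Finset.mem_image_of_mem _ (by simp; omega)
    obtain ⟨p, hp⟩ := ih ⟨_, hmem⟩ hb
    have htr := hab.1.mono ht
    have hadj : (𝒢.windowGraph ν t₀ t₁ t).Adj (some a) (some ⟨_, hmem⟩) :=
      ⟨fun h => (underlying_adj_of_traversed hν htr).ne (congrArg Subtype.val h),
        ⟨htr, hab.2.1⟩, ⟨htr.symm, hab.2.2⟩⟩
    exact ⟨SimpleGraph.Walk.cons hadj p, by simp [hp]⟩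

/-- The window graph already contains edges that are traversed only after `t`, which makes it
decrease in time. This creates no shortcuts: the first such edge on a walk is still fresh at time
`t`, so the walk has met a target there. -/
theorem exists_reachesTarget_of_walk {t₀ t₁ t : ℕ}
    (hν : ∀ i < t₁, 𝒢.underlying.Adj (ν i) (ν (i + 1)))
    {x y : Option ((Finset.range (t₁ + 1)).image ν)} (p : (𝒢.windowGraph ν t₀ t₁ t).Walk x y)
    (hy : y = none) (a : (Finset.range (t₁ + 1)).image ν) (hx : x = some a)
    (ha : ∃ i ≤ t, ν i = a) :
    ∃ d, d + 1 ≤ p.length ∧ 𝒢.ReachesTarget ν t₀ t d a := by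
  induction p generalizing a with
  | nil => simp [hx] at hy
  | @cons x z y h p ih =>
    subst hx
    rcases z with _ | b
    · exact ⟨0, by simp, h⟩
    · have h' := h
      obtain ⟨-, ⟨htr, hs⟩, -, hs'⟩ := h'
      by_cases hab : Traversed ν t (a : V) b
      · obtain ⟨d, hd, hb⟩ := ih hy b rfl hab.symm.exists_left
        exact ⟨d + 1, by simp; omega, b, ⟨hab, hs, hs'⟩, hb⟩
      · exact ⟨0, by simp, Or.inr ⟨b, underlying_adj_of_traversed hν htr, hab, hs⟩⟩

/-- A new node is unvisited in the window, hence adjacent to the apex, and costs 2. Closing a cycle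
may lead anywhere, and costs at most the number of vertices of the cone. A pursuit step comes
closer, by the minimality of `d`. -/
theorem window_step {t₀ t₁ t : ℕ} (hν : ∀ i < t₁, 𝒢.underlying.Adj (ν i) (ν (i + 1)))
    (ht : t < t₁) (hmove : 𝒢.LegalMove ν t₀ t (ν (t + 1)))
    {a b : (Finset.range (t₁ + 1)).image ν} (ha : (a : V) = ν t) (hb : (b : V) = ν (t + 1)) :
    (𝒢.windowGraph ν t₀ t₁ t).dist (some b) none + 1 ≤
      (𝒢.windowGraph ν t₀ t₁ t).dist (some a) none +
        (2 * (visitCount ν (t + 1) - visitCount ν t) +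
          (visitCount ν t₁ + 1) * if ClosesCycle ν t then 1 else 0) := by
  rcases hmove with hfresh | ⟨d, halive, hd, hmin⟩
  · rw [visitCount_succ, Nat.add_sub_cancel_left]
    by_cases hvis : ∃ i ≤ t, ν i = ν (t + 1)
    · have hcl : ClosesCycle ν t := ⟨hvis, hfresh.2.1⟩
      have hlt := (𝒢.windowGraph ν t₀ t₁ t).dist_lt_fintypeCard (some b) none
      rw [Fintype.card_option, Fintype.card_coe] at hlt
      rw [if_pos hvis, if_pos hcl]
      rw [visitCount]
      omega
    · have htb : (𝒢.windowGraph ν t₀ t₁ t).Adj (some b) none :=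
        Or.inl fun j _ hj hjb => hvis ⟨j, hj, hjb.trans hb⟩
      rw [if_neg hvis, SimpleGraph.dist_eq_one_iff_adj.2 htb]
      omega
  · obtain ⟨p, hp⟩ := exists_walk_of_reachesTarget hν ht.le d b (by rwa [hb])
    have h1 := SimpleGraph.dist_le p
    obtain ⟨q, -⟩ := exists_walk_of_reachesTarget (𝒢 := 𝒢) (t₀ := t₀) hν ht.le (d + 1) a
      ⟨ν (t + 1), by rwa [ha], hd⟩
    obtain ⟨q', hq'⟩ := q.reachable.exists_walk_length_eq_dist
    obtain ⟨d', hd', hr⟩ := exists_reachesTarget_of_walk hν q' rfl a rfl ⟨t, le_rfl, ha.symm⟩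
    have : d < d' := by
      by_contra! hle
      exact hmin d' hle (by rwa [← ha])
    omega

end

/-- A window in which no target gets lost is short unless many cycles are closed. -/
theorem window_length_le {t₀ t₁ : ℕ} (h₀₁ : t₀ ≤ t₁)
    (hν : ∀ i < t₁, 𝒢.underlying.Adj (ν i) (ν (i + 1)))
    (hmove : ∀ t, t₀ ≤ t → t ≤ t₁ → 𝒢.LegalMove ν t₀ t (ν (t + 1))) :
    t₁ - t₀ ≤ windowBudget (visitCount ν t₁) (edgeCount ν t₁) +
      (visitCount ν t₁ + 1) * (cycleCount ν t₁ - cycleCount ν t₀) := by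
  classical
  set K := (Finset.range (t₁ + 1)).image ν with hK
  have hmem : ∀ t ≤ t₁, ν t ∈ K := fun t ht => Finset.mem_image_of_mem _ (by simp; omega)
  have hcardK : K.card = visitCount ν t₁ := by
    rw [visitCount]
  let x : ℕ → Option K := fun t => if h : ν t ∈ K then some ⟨ν t, h⟩ else none
  have hx : ∀ t (ht : t ≤ t₁), x t = some ⟨ν t, hmem t ht⟩ := fun t ht => dif_pos (hmem t ht)
  have hmain := pursuit_length_le
    (G := coneGraph (fun a b : K => Traversed ν t₁ (a : V) b) fun _ => True)
    (coneGraph_connected fun _ => trivial) none (fun t => 𝒢.windowGraph ν t₀ t₁ t) x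
    (fun t => 2 * (visitCount ν (t + 1) - visitCount ν t) +
      (visitCount ν t₁ + 1) * if ClosesCycle ν t then 1 else 0) h₀₁
    (coneGraph_mono (fun _ _ h => h.1) fun _ _ => trivial)
    (fun t _ _ => windowGraph_le (Nat.le_add_right t 1)) (fun t h₀ h₁ => ?_) fun t h₀ h₁ => ?_
  · have hsum : ∀ t, t₀ ≤ t → ∑ i ∈ Finset.Ico t₀ t,
        (2 * (visitCount ν (i + 1) - visitCount ν i) +
          (visitCount ν t₁ + 1) * if ClosesCycle ν i then 1 else 0) =
        2 * (visitCount ν t - visitCount ν t₀) +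
          (visitCount ν t₁ + 1) * (cycleCount ν t - cycleCount ν t₀) := by
      intro t ht
      induction t, ht using Nat.le_induction with
      | base => simp
      | succ t ht ih =>
        rw [Finset.sum_Ico_succ_top ht, ih]
        have h1 := visitCount_mono (ν := ν) ht
        have h2 := visitCount_mono (ν := ν) (Nat.le_add_right t 1)
        have h3 := cycleCount_mono (ν := ν) ht
        have h4 : cycleCount ν (t + 1) - cycleCount ν t₀ =
            (cycleCount ν t - cycleCount ν t₀) + if ClosesCycle ν t then 1 else 0 := by
          rw [cycleCount, Finset.sum_range_succ, ← cycleCount]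
          omega
        rw [h4, mul_add]
        omega
    have hcard : Fintype.card (Option K) = visitCount ν t₁ + 1 := by
      rw [Fintype.card_option, Fintype.card_coe, hcardK]
    rw [hsum _ h₀₁, hcard] at hmain
    have hedges := ncard_edgeSet_coneGraph_le ν t₁
    have hbud := deletionBudget_mono (N := visitCount ν t₁ + 1) (by omega) le_rfl hedges
    -- The summand `3 * n + 1` collects the `n + 1` vertices of the cone and 2 for each new node.
    rw [windowBudget]
    have hmain' := hmain.trans (Nat.add_le_add_right (Nat.add_le_add_left hbud _) _)
    omega
  · rw [hx t h₁]
    obtain ⟨d, hd⟩ := (hmove t h₀ h₁).exists_reachesTarget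
    obtain ⟨p, -⟩ := exists_walk_of_reachesTarget hν h₁ d ⟨ν t, hmem t h₁⟩ hd
    exact p.reachable
  · rw [hx t h₁.le, hx (t + 1) h₁]
    exact window_step hν h₁ (hmove t h₀ h₁.le) rfl rfl

theorem visitCount_le (t : ℕ) : visitCount ν t ≤ Fintype.card V := by
  classical
  exact Finset.card_le_univ _

theorem edgeCount_le {t : ℕ} (hν : ∀ i < t, 𝒢.underlying.Adj (ν i) (ν (i + 1))) :
    edgeCount ν t ≤ 𝒢.numEdges := by
  classical
  rw [edgeCount, numEdges, ← Set.ncard_coe_finset]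
  refine Set.ncard_le_ncard (fun e he => ?_) (Set.toFinite _)
  obtain ⟨i, hi, rfl⟩ := Finset.mem_image.1 (Finset.mem_coe.1 he)
  exact hν i (by simpa using hi)

/-- Completed windows are paid for by the cycles closed in them. -/
theorem windowStart_le_cycleCount {t : ℕ}
    (hmove : ∀ i < t, 𝒢.LegalMove ν (windowStart ν i) i (ν (i + 1))) :
    windowStart ν t ≤ 2 * (Fintype.card V + 1) * cycleCount ν (windowStart ν t) := by
  induction t with
  | zero => simp [windowStart]
  | succ t ih =>
    have ih' := ih fun i hi => hmove i (by omega)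
    rw [windowStart]
    split_ifs with hc
    -- A finished window is longer than four budgets, of which the cycle-free part explains only
    -- one. The other three are at most `(n + 1) * c` for the `c` cycles closed in it, so twice this
    -- amount covers the whole window, including its last step.
    · have hle := windowStart_le (ν := ν) t
      have hν : ∀ i < t, 𝒢.underlying.Adj (ν i) (ν (i + 1)) := fun i hi =>
        𝒢.snapshot_le i ((hmove i (by omega)).adj (windowStart_le i))
      have hw := window_length_le (𝒢 := 𝒢) hle hν fun i h₀ hi => by
        have := hmove i (by omega)
        rwa [windowStart_eq_of_le h₀ hi] at this
      have hbud := windowBudget_mono (visitCount_mono (ν := ν) (Nat.le_add_right t 1))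
        (edgeCount_mono (ν := ν) (Nat.le_add_right t 1))
      have hpos : 1 ≤ windowBudget (visitCount ν t) (edgeCount ν t) := by
        rw [windowBudget]
        omega
      have hcyc := cycleCount_mono (ν := ν) hle
      have hcyc' := cycleCount_mono (ν := ν) (Nat.le_add_right t 1)
      have hvis : (visitCount ν t + 1) * (cycleCount ν t - cycleCount ν (windowStart ν t)) ≤
          (Fintype.card V + 1) * (cycleCount ν t - cycleCount ν (windowStart ν t)) :=
        Nat.mul_le_mul_right _ (by have := visitCount_le (ν := ν) t; omega)
      obtain ⟨c, hc'⟩ := Nat.exists_eq_add_of_le hcyc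
      rw [hc', Nat.add_sub_cancel_left] at hvis hw
      have h1 : 2 * (Fintype.card V + 1) * cycleCount ν t ≤
          2 * (Fintype.card V + 1) * cycleCount ν (t + 1) := Nat.mul_le_mul_left _ hcyc'
      rw [hc', mul_add, mul_assoc 2 _ c] at h1
      omega
    · exact ih'

theorem time_le_of_legalMoves {t : ℕ}
    (hmove : ∀ i < t, 𝒢.LegalMove ν (windowStart ν i) i (ν (i + 1))) :
    t ≤ 2 * (Fintype.card V + 1) * cycleCount ν t +
      4 * windowBudget (Fintype.card V) 𝒢.numEdges := by
  have hν : ∀ i < t, 𝒢.underlying.Adj (ν i) (ν (i + 1)) := fun i hi =>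
    𝒢.snapshot_le i ((hmove i hi).adj (windowStart_le i))
  have h1 := windowStart_le_cycleCount hmove
  have h2 := sub_windowStart_le (ν := ν) t
  have h3 := windowBudget_mono (visitCount_le (ν := ν) t) (edgeCount_le hν)
  have h4 := Nat.mul_le_mul_left (2 * (Fintype.card V + 1))
    (cycleCount_mono (ν := ν) (windowStart_le (ν := ν) t))
  omega

/-- If no target can be reached, then all nodes have been visited. -/
theorem forall_visited_of_not_reachesTarget {T t : ℕ} (hT : 𝒢.IntervalConnected T)
    {t₀ : ℕ} (ht₀ : t₀ ≤ t) (ht : t < t₀ + T)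
    (hstuck : ∀ d, ¬ 𝒢.ReachesTarget ν t₀ t d (ν t)) (v : V) : ∃ i ≤ t, ν i = v := by
  obtain ⟨p⟩ := (hT t₀).preconnected (ν t) v
  -- Along edges present throughout the window, the invariant is that the node is visited and
  -- reaches no target: a traversed edge is alive and passes it on, and an untraversed one would be
  -- fresh.
  have key : ∀ {a b : V} (_ : (⨅ i : Fin T, 𝒢.snapshot (t₀ + i)).Walk a b), (∃ i ≤ t, ν i = a) →
      (∀ d, ¬ 𝒢.ReachesTarget ν t₀ t d a) → ∃ i ≤ t, ν i = b := by
    intro a b p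
    induction p with
    | nil => exact fun h _ => h
    | @cons a c b hac _ ih =>
      intro _ ha
      have hsnap : ∀ j, t₀ ≤ j → j ≤ t → (𝒢.snapshot j).Adj a c := by
        intro j h₀ hj
        have := iInf_le (fun i : Fin T => 𝒢.snapshot (t₀ + i)) ⟨j - t₀, by omega⟩ hac
        simpa [Nat.add_sub_cancel' h₀] using this
      have hs : 𝒢.SeenFrom ν t₀ t a c := fun j h₀ hj _ => hsnap j h₀ hj
      have hs' : 𝒢.SeenFrom ν t₀ t c a := fun j h₀ hj _ => (hsnap j h₀ hj).symm
      by_cases htr : Traversed ν t a c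
      · exact ih htr.symm.exists_left fun d hd => ha (d + 1) ⟨c, ⟨htr, hs, hs'⟩, hd⟩
      · exact absurd (Or.inr ⟨c, 𝒢.snapshot_le t (hsnap t ht₀ le_rfl), htr, hs⟩) (ha 0)
  exact key p ⟨t, le_rfl, rfl⟩ hstuck

end DynGraph

/-! ### The rule in terms of observations -/

section Strategy

/-!
Below, `o i` is the observation at time `i`, `act i` is the port through which the agent left at
time `i`, and nodes are represented by their labels.
-/

variable (o : ℕ → Observation) (act : ℕ → ℕ)

/-- The agent has traversed an edge before time `t`, which leads from `x`, port `p`, to `y`. -/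
def Linked (t x p y : ℕ) : Prop :=
  ∃ i < t, ((o i).label = x ∧ act i = p ∧ (o (i + 1)).label = y) ∨
    ((o i).label = y ∧ (o (i + 1)).inPort = some p ∧ (o (i + 1)).label = x)

/-- The port `p` of `x` was available at all visits in the window. -/
def Available (t₀ t x p : ℕ) : Prop :=
  ∀ j, t₀ ≤ j → j ≤ t → (o j).label = x → p ∈ (o j).ports

/-- The port `p` of `x` is unused, and was available at all visits in the window. -/
def FreshPort (t₀ t x p : ℕ) : Prop :=
  (∀ y, ¬ Linked o act t x p y) ∧ Available o t₀ t x p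

/-- The node `x` has not been visited in the window, or it has a fresh port. -/
def IsTargetLabel (t₀ t x : ℕ) : Prop :=
  (∀ j, t₀ ≤ j → j ≤ t → (o j).label ≠ x) ∨ ∃ p, FreshPort o act t₀ t x p

/-- A traversed edge leads from `x`, port `p`, to `y`, and was never seen missing in the window. -/
def AlivePort (t₀ t x p y : ℕ) : Prop :=
  ∃ p', Linked o act t x p y ∧ Linked o act t y p' x ∧ Available o t₀ t x p ∧
    Available o t₀ t y p'

/-- There is a path of `d` alive edges from a node to a target. -/
def ReachesTargetLabel (t₀ t : ℕ) : ℕ → ℕ → Prop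
  | 0, x => IsTargetLabel o act t₀ t x
  | d + 1, x => ∃ p y, AlivePort o act t₀ t x p y ∧ ReachesTargetLabel t₀ t d y

/-- The ports that the agent may choose at time `t`. -/
def LegalPort (t₀ t p : ℕ) : Prop :=
  FreshPort o act t₀ t (o t).label p ∨
    ∃ d y, AlivePort o act t₀ t (o t).label p y ∧ ReachesTargetLabel o act t₀ t d y ∧
      ∀ d' ≤ d, ¬ ReachesTargetLabel o act t₀ t d' (o t).label

open Classical in
/-- The choice of the agent at time `t`. -/
noncomputable def choosePort (t : ℕ) : Option ℕ :=
  if h : ∃ p, LegalPort o act (windowStart (fun i => (o i).label) t) t p then some h.choose else none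

/-- The choice of the agent after the given observations and actions, and a new observation. -/
noncomputable def nextAction (past : List (Observation × Option ℕ)) (new : Observation) :
    Option ℕ :=
  -- The default `new` supplies the observation at the current time `past.length`; the default ports
  -- 0 are never consulted at times before it in an actual run.
  choosePort (fun i => ((past.map Prod.fst)[i]?).getD new)
    (fun i => ((past.map fun q => q.2.getD 0)[i]?).getD 0) past.length

/-- The observations so far with the actions of the agent. -/
noncomputable def transcript (h : List Observation) : List (Observation × Option ℕ) :=
  -- An algorithm receives observations only, so its own earlier actions are recomputed.
  h.foldl (fun past new => past ++ [(new, nextAction past new)]) []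

/-- The exploration algorithm. -/
noncomputable def explore : Algorithm := fun h =>
  ((transcript h).getLast?).bind Prod.snd

theorem transcript_append (h : List Observation) (new : Observation) :
    transcript (h ++ [new]) = transcript h ++ [(new, nextAction (transcript h) new)] := by
  simp [transcript]

theorem explore_append (h : List Observation) (new : Observation) :
    explore (h ++ [new]) = nextAction (transcript h) new := by
  simp [explore, transcript_append]

end Strategy

/-! ### Translation between observations and the graph -/

namespace DynGraph

variable {V : Type} [Fintype V] {𝒢 : DynGraph V} {ν : ℕ → V}

theorem port_inj {v a b : V} (ha : 𝒢.underlying.Adj v a) (hb : 𝒢.underlying.Adj v b) :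
    𝒢.port v a = 𝒢.port v b ↔ a = b :=
  ⟨fun h => (𝒢.port_bijOn v).injOn ha hb h, fun h => h ▸ rfl⟩

theorem port_mem_availablePorts {v b : V} {t : ℕ} (hb : 𝒢.underlying.Adj v b) :
    𝒢.port v b ∈ 𝒢.availablePorts v t ↔ (𝒢.snapshot t).Adj v b := by
  classical
  simp only [availablePorts, Finset.mem_image, Finset.mem_filter, Finset.mem_univ, true_and]
  refine ⟨?_, fun h => ⟨b, h, rfl⟩⟩
  rintro ⟨u, hu, he⟩
  rwa [← (port_inj (𝒢.snapshot_le t hu) hb).1 he]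

theorem exists_port_of_mem_availablePorts {v : V} {t p : ℕ} (hp : p ∈ 𝒢.availablePorts v t) :
    ∃ b, (𝒢.snapshot t).Adj v b ∧ p = 𝒢.port v b := by
  classical
  simp only [availablePorts, Finset.mem_image, Finset.mem_filter, Finset.mem_univ, true_and] at hp
  obtain ⟨u, hu, he⟩ := hp
  exact ⟨u, hu, he.symm⟩

section Translation

variable {o : ℕ → Observation} {act : ℕ → ℕ} {t₀ t : ℕ}

/-- One traversal reveals the ports at both ends: the departure port was chosen by the agent, and
the arrival port is observed. -/
theorem linked_iff (ho : ∀ i ≤ t, o i = 𝒢.observation ν i)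
    (hact : ∀ i < t, act i = 𝒢.port (ν i) (ν (i + 1))) {a : V} {p y : ℕ} :
    Linked o act t (𝒢.label a) p y ↔
      ∃ b, y = 𝒢.label b ∧ Traversed ν t a b ∧ p = 𝒢.port a b := by
  constructor
  · rintro ⟨i, hi, h⟩
    rw [ho i hi.le, ho (i + 1) hi] at h
    rcases h with ⟨h1, h2, h3⟩ | ⟨h1, h2, h3⟩
    · have h1' := 𝒢.label_injective h1
      refine ⟨ν (i + 1), h3.symm, ⟨i, hi, Or.inl ⟨h1', rfl⟩⟩, ?_⟩
      rw [← h2, hact i hi, ← h1']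
    · have h3' := 𝒢.label_injective h3
      refine ⟨ν i, h1.symm, ⟨i, hi, Or.inr ⟨rfl, h3'⟩⟩, ?_⟩
      simp only [observation, Nat.add_eq_zero_iff, one_ne_zero, and_false, if_false,
        Nat.add_sub_cancel, Option.some.injEq] at h2
      rw [← h2, h3']
  · rintro ⟨b, rfl, ⟨i, hi, ⟨rfl, rfl⟩ | ⟨rfl, rfl⟩⟩, rfl⟩
    · refine ⟨i, hi, Or.inl ?_⟩
      rw [ho i hi.le, ho (i + 1) hi]
      exact ⟨rfl, hact i hi, rfl⟩
    · refine ⟨i, hi, Or.inr ?_⟩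
      rw [ho i hi.le, ho (i + 1) hi]
      exact ⟨rfl, by simp [observation], rfl⟩

theorem available_iff (ho : ∀ i ≤ t, o i = 𝒢.observation ν i) {a b : V}
    (hab : 𝒢.underlying.Adj a b) :
    Available o t₀ t (𝒢.label a) (𝒢.port a b) ↔ 𝒢.SeenFrom ν t₀ t a b := by
  constructor
  · rintro h j h₀ hj rfl
    have := h j h₀ hj (by rw [ho j hj]; rfl)
    rw [ho j hj] at this
    exact (port_mem_availablePorts hab).1 this
  · intro h j h₀ hj hja
    rw [ho j hj] at hja ⊢
    have hja' := 𝒢.label_injective hja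
    have := (port_mem_availablePorts hab).2 (h j h₀ hj hja')
    simpa [observation, hja'] using this

/-- The visit in the window is essential: without one, every unused number would count as available,
even if it is no port of the node. -/
theorem freshPort_iff (ho : ∀ i ≤ t, o i = 𝒢.observation ν i)
    (hact : ∀ i < t, act i = 𝒢.port (ν i) (ν (i + 1)))
    (hν : ∀ i < t, 𝒢.underlying.Adj (ν i) (ν (i + 1))) {a : V} {p : ℕ}
    (hvis : ∃ j, t₀ ≤ j ∧ j ≤ t ∧ ν j = a) :
    FreshPort o act t₀ t (𝒢.label a) p ↔ ∃ b, 𝒢.Fresh ν t₀ t a b ∧ p = 𝒢.port a b := by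
  constructor
  · rintro ⟨h1, h2⟩
    obtain ⟨j, h₀, hj, rfl⟩ := hvis
    have hp := h2 j h₀ hj (by rw [ho j hj]; rfl)
    rw [ho j hj] at hp
    obtain ⟨b, hb, rfl⟩ := exists_port_of_mem_availablePorts hp
    have hb' := 𝒢.snapshot_le j hb
    exact ⟨b, ⟨hb', fun htr => h1 _ ((linked_iff ho hact).2 ⟨b, rfl, htr, rfl⟩),
      (available_iff ho hb').1 h2⟩, rfl⟩
  · rintro ⟨b, ⟨h1, h2, h3⟩, rfl⟩
    refine ⟨fun y hy => ?_, (available_iff ho h1).2 h3⟩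
    obtain ⟨c, -, hc, hp⟩ := (linked_iff ho hact).1 hy
    obtain rfl := (port_inj h1 (underlying_adj_of_traversed hν hc)).1 hp
    exact h2 hc

theorem isTargetLabel_iff (ho : ∀ i ≤ t, o i = 𝒢.observation ν i)
    (hact : ∀ i < t, act i = 𝒢.port (ν i) (ν (i + 1)))
    (hν : ∀ i < t, 𝒢.underlying.Adj (ν i) (ν (i + 1))) {a : V} :
    IsTargetLabel o act t₀ t (𝒢.label a) ↔ 𝒢.IsTarget ν t₀ t a := by
  by_cases hvis : ∃ j, t₀ ≤ j ∧ j ≤ t ∧ ν j = a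
  · obtain ⟨j, h₀, hj, hja⟩ := hvis
    have h1 : ¬ ∀ j, t₀ ≤ j → j ≤ t → (o j).label ≠ 𝒢.label a := fun h =>
      h j h₀ hj (by rw [ho j hj, ← hja]; rfl)
    have h2 : ¬ ∀ j, t₀ ≤ j → j ≤ t → ν j ≠ a := fun h => h j h₀ hj hja
    simp only [IsTargetLabel, IsTarget, h1, h2, false_or,
      freshPort_iff ho hact hν ⟨j, h₀, hj, hja⟩]
    exact ⟨fun ⟨_, b, hb, _⟩ => ⟨b, hb⟩, fun ⟨b, hb⟩ => ⟨_, b, hb, rfl⟩⟩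
  · push Not at hvis
    refine iff_of_true (Or.inl fun j h₀ hj hja => ?_) (Or.inl hvis)
    rw [ho j hj] at hja
    exact hvis j h₀ hj (𝒢.label_injective hja)

theorem alivePort_iff (ho : ∀ i ≤ t, o i = 𝒢.observation ν i)
    (hact : ∀ i < t, act i = 𝒢.port (ν i) (ν (i + 1)))
    (hν : ∀ i < t, 𝒢.underlying.Adj (ν i) (ν (i + 1))) {a : V} {p y : ℕ} :
    AlivePort o act t₀ t (𝒢.label a) p y ↔
      ∃ b, y = 𝒢.label b ∧ 𝒢.Alive ν t₀ t a b ∧ p = 𝒢.port a b := by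
  constructor
  · rintro ⟨p', h1, h2, h3, h4⟩
    obtain ⟨b, rfl, htr, rfl⟩ := (linked_iff ho hact).1 h1
    obtain ⟨c, hc, -, rfl⟩ := (linked_iff ho hact).1 h2
    obtain rfl := 𝒢.label_injective hc
    have hab := underlying_adj_of_traversed hν htr
    exact ⟨b, rfl, ⟨htr, (available_iff ho hab).1 h3, (available_iff ho hab.symm).1 h4⟩, rfl⟩
  · rintro ⟨b, rfl, ⟨htr, h3, h4⟩, rfl⟩
    have hab := underlying_adj_of_traversed hν htr
    exact ⟨𝒢.port b a, (linked_iff ho hact).2 ⟨b, rfl, htr, rfl⟩,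
      (linked_iff ho hact).2 ⟨a, rfl, htr.symm, rfl⟩, (available_iff ho hab).2 h3,
      (available_iff ho hab.symm).2 h4⟩

theorem reachesTargetLabel_iff (ho : ∀ i ≤ t, o i = 𝒢.observation ν i)
    (hact : ∀ i < t, act i = 𝒢.port (ν i) (ν (i + 1)))
    (hν : ∀ i < t, 𝒢.underlying.Adj (ν i) (ν (i + 1))) (d : ℕ) :
    ∀ a, ReachesTargetLabel o act t₀ t d (𝒢.label a) ↔ 𝒢.ReachesTarget ν t₀ t d a := by
  induction d with
  | zero => exact fun a => isTargetLabel_iff ho hact hν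
  | succ d ih =>
    intro a
    constructor
    · rintro ⟨p, y, h, h'⟩
      obtain ⟨b, rfl, hb, -⟩ := (alivePort_iff ho hact hν).1 h
      exact ⟨b, hb, (ih b).1 h'⟩
    · rintro ⟨b, hb, h'⟩
      exact ⟨_, _, (alivePort_iff ho hact hν).2 ⟨b, rfl, hb, rfl⟩, (ih b).2 h'⟩

theorem legalPort_iff (ho : ∀ i ≤ t, o i = 𝒢.observation ν i)
    (hact : ∀ i < t, act i = 𝒢.port (ν i) (ν (i + 1)))
    (hν : ∀ i < t, 𝒢.underlying.Adj (ν i) (ν (i + 1))) (h₀ : t₀ ≤ t) {p : ℕ} :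
    LegalPort o act t₀ t p ↔ ∃ b, 𝒢.LegalMove ν t₀ t b ∧ p = 𝒢.port (ν t) b := by
  have hlab : (o t).label = 𝒢.label (ν t) := by rw [ho t le_rfl]; rfl
  rw [LegalPort, hlab, freshPort_iff ho hact hν ⟨t, h₀, le_rfl, rfl⟩]
  simp only [reachesTargetLabel_iff ho hact hν]
  constructor
  · rintro (⟨b, hb, rfl⟩ | ⟨d, y, hy, hd, hmin⟩)
    · exact ⟨b, Or.inl hb, rfl⟩
    · obtain ⟨b, rfl, hb, rfl⟩ := (alivePort_iff ho hact hν).1 hy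
      exact ⟨b, Or.inr ⟨d, hb, (reachesTargetLabel_iff ho hact hν d b).1 hd, hmin⟩, rfl⟩
  · rintro ⟨b, hb | ⟨d, hb, hd, hmin⟩, rfl⟩
    · exact Or.inl ⟨b, hb, rfl⟩
    · exact Or.inr ⟨d, _, (alivePort_iff ho hact hν).2 ⟨b, rfl, hb, rfl⟩,
        (reachesTargetLabel_iff ho hact hν d b).2 hd, hmin⟩

theorem windowStart_label (ho : ∀ i ≤ t, o i = 𝒢.observation ν i) :
    windowStart (fun i => (o i).label) t = windowStart ν t :=
  windowStart_congr 𝒢.label_injective fun i hi => by rw [ho i hi]; rfl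

theorem legalMove_of_choosePort (ho : ∀ i ≤ t, o i = 𝒢.observation ν i)
    (hact : ∀ i < t, act i = 𝒢.port (ν i) (ν (i + 1)))
    (hν : ∀ i < t, 𝒢.underlying.Adj (ν i) (ν (i + 1))) {p : ℕ}
    (h : choosePort o act t = some p) :
    ∃ b, 𝒢.LegalMove ν (windowStart ν t) t b ∧ p = 𝒢.port (ν t) b := by
  rw [choosePort] at h
  split_ifs at h with hp
  rw [Option.some.injEq] at h
  have := hp.choose_spec
  rw [h, windowStart_label ho] at this
  exact (legalPort_iff ho hact hν (windowStart_le t)).1 this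

/-- At the least distance `d` to a target, a fresh edge or the first edge of the path would be a
legal move. -/
theorem not_reachesTarget_of_choosePort (ho : ∀ i ≤ t, o i = 𝒢.observation ν i)
    (hact : ∀ i < t, act i = 𝒢.port (ν i) (ν (i + 1)))
    (hν : ∀ i < t, 𝒢.underlying.Adj (ν i) (ν (i + 1)))
    (h : choosePort o act t = none) (d : ℕ) :
    ¬ 𝒢.ReachesTarget ν (windowStart ν t) t d (ν t) := by
  rw [choosePort] at h
  split_ifs at h with hp
  rw [windowStart_label ho] at hp
  simp only [legalPort_iff ho hact hν (windowStart_le t)] at hp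
  have hno : ∀ b, ¬ 𝒢.LegalMove ν (windowStart ν t) t b := fun b hb => hp ⟨_, b, hb, rfl⟩
  induction d using Nat.strong_induction_on with
  | _ d ih =>
    intro hd
    cases d with
    | zero =>
      rcases hd with hd | ⟨b, hb⟩
      · exact hd t (windowStart_le t) le_rfl rfl
      · exact hno b (Or.inl hb)
    | succ d =>
      obtain ⟨b, hb, hd⟩ := hd
      exact hno b (Or.inr ⟨d, hb, hd, fun d' hd' => ih d' (by omega)⟩)

end Translation

/-! ### Runs of the algorithm -/

section Run

theorem history_congr {ν' : ℕ → V} {t : ℕ} (h : ∀ i ≤ t, ν i = ν' i) :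
    𝒢.history ν t = 𝒢.history ν' t := by
  rw [history, history]
  refine List.map_congr_left fun i hi => ?_
  have hi' : i ≤ t := by simpa [Nat.lt_succ_iff] using hi
  rw [observation, observation, h i hi', h (i - 1) (by omega)]

variable (𝒢) in
/-- There is a trajectory that follows a given algorithm as long as this is possible. -/
theorem exists_trajectory (A : Algorithm) (v₀ : V) : ∃ ν : ℕ → V, ν 0 = v₀ ∧ ∀ t,
    (∃ b, (𝒢.snapshot t).Adj (ν t) b ∧ A (𝒢.history ν t) = some (𝒢.port (ν t) b)) →
      𝒢.Moves A ν t := by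
  classical
  let next : (ℕ → V) → ℕ → V := fun ν t =>
    if h : ∃ b, (𝒢.snapshot t).Adj (ν t) b ∧ A (𝒢.history ν t) = some (𝒢.port (ν t) b) then
      h.choose else ν t
  -- The approximation `approx k` is final up to time `k`; the trajectory is the diagonal.
  let approx : ℕ → ℕ → V := fun k => Nat.rec (fun _ => v₀)
    (fun t ν => Function.update ν (t + 1) (next ν t)) k
  have hsucc : ∀ k, approx (k + 1) = Function.update (approx k) (k + 1) (next (approx k) k) :=
    fun k => rfl
  have hstable : ∀ k i, i ≤ k → approx k i = approx i i := by
    intro k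
    induction k with
    | zero => intro i hi; rw [Nat.le_zero.1 hi]
    | succ k ih =>
      intro i hi
      rcases hi.eq_or_lt with rfl | hlt
      · rfl
      · rw [hsucc, Function.update_of_ne (by omega), ih i (by omega)]
  refine ⟨fun t => approx t t, rfl, fun t ht => ?_⟩
  have hh : 𝒢.history (fun t => approx t t) t = 𝒢.history (approx t) t :=
    history_congr fun i hi => (hstable t i hi).symm
  rw [Moves]
  simp only [hh] at ht ⊢
  have hn : approx (t + 1) (t + 1) = ht.choose := by
    rw [hsucc, Function.update_self]
    exact dif_pos ht
  rw [hn]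
  exact ht.choose_spec

theorem map_range_getElem?_getD {β : Type*} (f : ℕ → β) (t i : ℕ) (b : β) :
    (((List.range t).map f)[i]?).getD b = if i < t then f i else b := by
  split_ifs with h
  · simp [h]
  · simp [h]

/-- The transcript of a run of the exploration algorithm. -/
theorem transcript_eq {t : ℕ} (hmoves : ∀ i < t, 𝒢.Moves explore ν i) :
    transcript ((List.range t).map (𝒢.observation ν)) =
      (List.range t).map fun i => (𝒢.observation ν i, some (𝒢.port (ν i) (ν (i + 1)))) := by
  induction t with
  | zero => rfl
  | succ t ih =>
    have hm := (hmoves t (by omega)).2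
    rw [history, List.range_succ, List.map_append, List.map_singleton, explore_append] at hm
    rw [List.range_succ, List.map_append, List.map_singleton, transcript_append, hm,
      ih fun i hi => hmoves i (by omega), List.map_append, List.map_singleton]

theorem explore_history {t : ℕ} (hmoves : ∀ i < t, 𝒢.Moves explore ν i) :
    ∃ (o : ℕ → Observation) (act : ℕ → ℕ), (∀ i ≤ t, o i = 𝒢.observation ν i) ∧
      (∀ i < t, act i = 𝒢.port (ν i) (ν (i + 1))) ∧
      explore (𝒢.history ν t) = choosePort o act t := by
  rw [history, List.range_succ, List.map_append, List.map_singleton, explore_append,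
    transcript_eq hmoves, nextAction, List.length_map, List.length_range, List.map_map,
    List.map_map]
  refine ⟨_, _, fun i hi => ?_, fun i hi => ?_, rfl⟩
  · rw [map_range_getElem?_getD]
    split_ifs with h
    · rfl
    · rw [show i = t by omega]
  · rw [map_range_getElem?_getD, if_pos hi]
    rfl

theorem Moves.underlying_adj {A : Algorithm} {t : ℕ} (h : 𝒢.Moves A ν t) :
    𝒢.underlying.Adj (ν t) (ν (t + 1)) := 𝒢.snapshot_le t h.1

theorem legalMove_of_moves {t : ℕ} (hmoves : ∀ i ≤ t, 𝒢.Moves explore ν i) :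
    𝒢.LegalMove ν (windowStart ν t) t (ν (t + 1)) := by
  obtain ⟨o, act, ho, hact, he⟩ := explore_history (t := t) fun i hi => hmoves i hi.le
  have hm := hmoves t le_rfl
  rw [Moves, he] at hm
  obtain ⟨b, hb, hp⟩ := legalMove_of_choosePort ho hact
    (fun i hi => (hmoves i hi.le).underlying_adj) hm.2
  rwa [(port_inj (𝒢.snapshot_le t hm.1)
    (𝒢.snapshot_le t (hb.adj (windowStart_le t)))).1 hp]

variable (𝒢) in
theorem exists_exploresInTime {T : ℕ} (hT : 𝒢.IntervalConnected T)
    (hT' : 4 * windowBudget (Fintype.card V) 𝒢.numEdges < T) (v₀ : V) :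
    ∃ s, 𝒢.ExploresInTime explore v₀ s ∧
      ∃ c, c + Fintype.card V ≤ 𝒢.numEdges + 1 ∧
        s ≤ 2 * (Fintype.card V + 1) * c + 4 * windowBudget (Fintype.card V) 𝒢.numEdges := by
  classical
  obtain ⟨ν, hν0, hν⟩ := 𝒢.exists_trajectory explore v₀
  have htime : ∀ t, (∀ i < t, 𝒢.Moves explore ν i) →
      t ≤ 2 * (Fintype.card V + 1) * cycleCount ν t +
        4 * windowBudget (Fintype.card V) 𝒢.numEdges := fun t ht =>
    time_le_of_legalMoves fun i hi => legalMove_of_moves fun j hj => ht j (by omega)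
  have hhalt : ∃ t, ¬ 𝒢.Moves explore ν t := by
    by_contra! hall
    set t := 2 * (Fintype.card V + 1) * (𝒢.numEdges + 1) +
      4 * windowBudget (Fintype.card V) 𝒢.numEdges + 1 with ht
    -- If the agent never halted, this time would exceed the bound that holds for every number of
    -- closed cycles up to `numEdges + 1`.
    have h1 := htime t fun i _ => hall i
    have h2 := cycleCount_add_visitCount_le (ν := ν) t
    have h3 := edgeCount_le (𝒢 := 𝒢) (ν := ν) (t := t) fun i _ => (hall i).underlying_adj
    have h4 := Nat.mul_le_mul_left (2 * (Fintype.card V + 1))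
      (by omega : cycleCount ν t ≤ 𝒢.numEdges + 1)
    omega
  set s := Nat.find hhalt
  have hmoves : ∀ i < s, 𝒢.Moves explore ν i := fun i hi => not_not.1 (Nat.find_min hhalt hi)
  have hadj : ∀ i < s, 𝒢.underlying.Adj (ν i) (ν (i + 1)) := fun i hi =>
    (hmoves i hi).underlying_adj
  obtain ⟨o, act, ho, hact, he⟩ := explore_history hmoves
  have hnone : choosePort o act s = none := by
    rw [Option.eq_none_iff_forall_ne_some]
    intro p hp
    obtain ⟨b, hb, rfl⟩ := legalMove_of_choosePort ho hact hadj hp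
    exact Nat.find_spec hhalt (hν s ⟨b, hb.adj (windowStart_le s), he.trans hp⟩)
  -- A window never exceeds four budgets, so the last one fits into the connectivity interval.
  have hlt : s < windowStart ν s + T := by
    have h1 := sub_windowStart_le (ν := ν) s
    have h2 := windowBudget_mono (visitCount_le (ν := ν) s) (edgeCount_le hadj)
    omega
  have hvis := forall_visited_of_not_reachesTarget hT (windowStart_le s) hlt
    (not_reachesTarget_of_choosePort ho hact hadj hnone)
  have hcard : visitCount ν s = Fintype.card V := by
    rw [visitCount, ← Finset.card_univ]
    congr 1
    refine Finset.eq_univ_iff_forall.2 fun v => ?_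
    obtain ⟨i, hi, rfl⟩ := hvis v
    exact Finset.mem_image_of_mem _ (by simp; omega)
  refine ⟨s, ⟨ν, hν0, hmoves, he.trans hnone, fun v => hvis v⟩, cycleCount ν s, ?_, htime s hmoves⟩
  have h1 := cycleCount_add_visitCount_le (ν := ν) s
  have h2 := edgeCount_le hadj
  omega

end Run

end DynGraph

/-! ### Constants and conclusion -/

section Main

theorem windowBudget_le {n m : ℕ} (hn : 3 ≤ n) (hnm : n ≤ m) (hm : m ≤ n.choose 2) :
    (windowBudget n m : ℝ) ≤ 404 * (explEps n m * m + n * Real.logb 2 n ^ 2) := by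
  have h1 := deletionBudget_le hn hnm hm
  have h2 := half_le_explEps hn hnm hm
  have h3 : (1 : ℝ) ≤ Real.logb 2 n := (one_le_log_of_three_le hn).trans (log_le_logb_two hn)
  have h4 : (n : ℝ) ≤ n * Real.logb 2 n ^ 2 :=
    le_mul_of_one_le_right (by positivity) (one_le_pow₀ h3)
  have h5 : (0 : ℝ) ≤ explEps n m * m := by positivity
  have h6 : (1 : ℝ) ≤ n := by exact_mod_cast (by omega : 1 ≤ n)
  rw [windowBudget]
  push_cast
  linarith

theorem explEps_mul_le {n m : ℕ} (hn : 3 ≤ n) (hnm : n ≤ m) :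
    explEps n m * m ≤ ((m : ℝ) - n + 1) * n + n * Real.logb 2 n ^ 2 := by
  have h1 := explEps_le_log hn hnm
  have h2 : Real.log n ≤ n := (Real.log_le_sub_one_of_pos (by positivity)).trans (by linarith)
  have h3 := log_le_logb_two hn
  have h4 := one_le_log_of_three_le hn
  have h5 : (n : ℝ) ≤ m := by exact_mod_cast hnm
  have h6 : Real.log n ≤ Real.logb 2 n ^ 2 := by nlinarith
  have h7 : explEps n m * m ≤ Real.log n * m := by gcongr
  have h8 : Real.log n * (m - n) ≤ n * (m - n) := mul_le_mul_of_nonneg_right h2 (by linarith)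
  have h9 : n * Real.log n ≤ n * Real.logb 2 n ^ 2 := by gcongr
  have h10 : (0 : ℝ) ≤ n := by positivity
  linarith

theorem theorem1 :
    ∃ (τ : ℕ → ℕ → ℕ) (A : Algorithm) (C₁ C₂ : ℝ),
      ∀ n m : ℕ, 3 ≤ n → n ≤ m → m ≤ n.choose 2 →
        1 ≤ τ n m ∧
        (τ n m : ℝ) ≤ C₁ * (explEps n m * m + n * Real.logb 2 n ^ 2) ∧
        ∀ (V : Type) [Fintype V] (𝒢 : DynGraph V),
          Fintype.card V = n → 𝒢.numEdges = m → 𝒢.IntervalConnected (τ n m) →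
          ∀ v₀ : V, ∃ s : ℕ,
            (s : ℝ) ≤ C₂ * (((m : ℝ) - n + 1) * n + n * Real.logb 2 n ^ 2) ∧
            𝒢.ExploresInTime A v₀ s := by
  -- Here `1617 = 4 * 404 + 1`, and `3236 = 4 + 2 * 4 * 404`: the 4 pays for cycles, as `2 * (n + 1)
  -- ≤ 4 * n`, and the factor 2 for the additional `n log² n` from `explEps_mul_le`.
  refine ⟨fun n m => 4 * windowBudget n m + 1, explore, 1617, 3236, fun n m hn hnm hm => ?_⟩
  have hbud := windowBudget_le hn hnm hm
  have heps := explEps_mul_le hn hnm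
  have hhalf := half_le_explEps hn hnm hm
  have hlogb : (1 : ℝ) ≤ Real.logb 2 n := (one_le_log_of_three_le hn).trans (log_le_logb_two hn)
  have hn1 : (3 : ℝ) ≤ n := by exact_mod_cast hn
  have hnm' : (n : ℝ) ≤ m := by exact_mod_cast hnm
  have hnl : (n : ℝ) ≤ n * Real.logb 2 n ^ 2 :=
    le_mul_of_one_le_right (by positivity) (one_le_pow₀ hlogb)
  have hem : (0 : ℝ) ≤ explEps n m * m := by positivity
  refine ⟨Nat.le_add_left 1 _, by push_cast; linarith, fun V _ 𝒢 hV hE hT v₀ => ?_⟩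
  subst hV hE
  obtain ⟨s, hs, c, hc, hsc⟩ := 𝒢.exists_exploresInTime hT (Nat.lt_succ_self _) v₀
  refine ⟨s, ?_, hs⟩
  set n := Fintype.card V
  set m := 𝒢.numEdges
  have h1 : (s : ℝ) ≤ 2 * ((n : ℝ) + 1) * c + 4 * windowBudget n m := by exact_mod_cast hsc
  have h2 : (c : ℝ) ≤ (m : ℝ) - n + 1 := by
    have : (c : ℝ) + n ≤ m + 1 := by exact_mod_cast hc
    linarith
  have h3 : 2 * ((n : ℝ) + 1) * c ≤ 4 * (((m : ℝ) - n + 1) * n) := by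
    have := mul_le_mul_of_nonneg_left h2 (by positivity : 0 ≤ 2 * ((n : ℝ) + 1))
    nlinarith
  have h4 : 0 ≤ ((m : ℝ) - n + 1) * n := mul_nonneg (by linarith) (by linarith)
  linarith

end Main
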